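/- Let $\mathcal H=\mathbb C^2$. For density operators put $b(\rho,\sigma)=\sqrt{1-\mathrm{Tr}\,|\sqrt\rho\sqrt\sigma|}$ (Bures distance). For $n\ge 0$ let $Y_n=\{\mathbf n=(n_1,n_2)\in\mathbb N^2 : n_1\ge n_2,\ n_1+n_2=n\}$, let $\mathcal W_{\mathbf n}\subseteq\mathcal H^{\otimes n}$ be the Young block of $\mathbf n$, i.e. the sum of all irreducible subrepresentations with highest weight $\mathbf n$ of the representation $U\mapsto U^{\otimes n}$ of $SU(2)$, and let $P_{\mathbf n}$ be the orthogonal projection onto $\mathcal W_{\mathbf n}$. For $\delta\ge 0$, $\mathbf k\in\mathbb Z^2$ with $k_1+k_2=n$, and the Euclidean norm, let $$M^{\delta,n}_{\mathbf k}=\frac1{C(n\delta)}\sum_{\mathbf n\in Y_n,\ \|\mathbf n-\mathbf k\|\le n\delta}P_{\mathbf n},\qquad C(x)=\#\{\mathbf k\in\mathbb Z^2:\|\mathbf k\|\le x,\ k_1+k_2=0\},$$ let $Y_{\delta,n}$ be the set of those $\mathbf k$ for which some $\mathbf n\in Y_n$ has $\|\mathbf n-\mathbf k\|\le n\delta$,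 and let $\mathcal H^{\delta,n}_{\mathbf k}=\bigoplus_{\mathbf n\in Y_n,\ \|\mathbf n-\mathbf k\|\le n\delta}\mathcal W_{\mathbf n}$. The variable-length code $(\mathbf E^{\delta,n},\mathbf D^{\delta,n})$ has data set $Y_{\delta,n}$, encoder $\mathbf E^{\delta,n}_{\mathbf k}(\rho)=\sqrt{M^{\delta,n}_{\mathbf k}}\,\rho\,\sqrt{M^{\delta,n}_{\mathbf k}}$ with values in the operators on $\mathcal H^{\delta,n}_{\mathbf k}$, and decoder $\mathbf D^{\delta,n}_{\mathbf k}$ given by the embedding of $\mathcal H^{\delta,n}_{\mathbf k}$ into $\mathcal H^{\otimes n}$. For $\delta=0$ this is the projective measurement onto the Young blocks: $Y_{0,n}=Y_n$ and $M^{0,n}_{\mathbf n}=P_{\mathbf n}$. For a discrete probability distribution $p$ on the density operators of $\mathcal H$, the average error of a variable-length code $(\mathbf E,\mathbf D)$ on $\mathcal H^{\otimes n}$ with data set $\Omega$ is $$\epsilon_{n,p}(\mathbf E,\mathbf D)=\sum_{\rho_1,\dots,\rho_n}p(\rho_1)\cdots p(\rho_n)\sum_{\omega\in\Omega}\mathrm{Tr}\,\mathbf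 E_\omega(\vec\rho_n)\;b^2\!\left(\vec\rho_n,\ \mathbf D_\omega\!\left(\frac{\mathbf E_\omega(\vec\rho_n)}{\mathrm{Tr}\,\mathbf E_\omega(\vec\rho_n)}\right)\right),\qquad \vec\rho_n=\rho_1\otimes\cdots\otimes\rho_n,$$ where terms with $\mathrm{Tr}\,\mathbf E_\omega(\vec\rho_n)=0$ count as $0$. A sequence of codes is universal for a family $\mathcal P$ of such distributions if its average error tends to $0$ for every $p\in\mathcal P$. Let $\{|e_1\rangle,|e_2\rangle\}$ be an orthonormal basis of $\mathbb C^2$ and let $p$ be a probability distribution with support exactly $\{|e_1\rangle\langle e_1|,|e_2\rangle\langle e_2|\}$. Then $(\mathbf E^{0,n},\mathbf D^{0,n})$ is a code for every $n$, in the sense that $\sum_{\mathbf k}\mathrm{Tr}\,\mathbf E^{0,n}_{\mathbf k}(\rho)=1$ for every density operator $\rho$ on $\mathcal H^{\otimes n}$; its average error $\epsilon_{n,p}(\mathbf E^{0,n},\mathbf D^{0,n})$ does not tend to $0$ as $n\to\infty$; hence the sequence $(\mathbf E^{0,n},\mathbf D^{0,n})_n$ is not universal for any family $\mathcal P$ containing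 $p$. -/

import Mathlib

open Filter Topology
open scoped CStarAlgebra

noncomputable section

namespace QuantumSource

/-! ### Operators, states, Bures distance -/

/-- The trace of an operator on a (finite-dimensional) Hilbert space. -/
def opTrace {E : Type} [NormedAddCommGroup E] [InnerProductSpace ℂ E] (A : E →L[ℂ] E) : ℂ :=
  LinearMap.trace ℂ E (A : E →ₗ[ℂ] E)

/-- The Bures distance `b(ρ, σ) = √(1 - Tr |√ρ √σ|)`. -/
def bures {E : Type} [NormedAddCommGroup E] [InnerProductSpace ℂ E] [CompleteSpace E]
    (ρ σ : E →L[ℂ] E) : ℝ :=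
  Real.sqrt (1 - (opTrace (CFC.abs (CFC.sqrt ρ * CFC.sqrt σ))).re)

/-- The density operators on `E`: positive operators of trace one. -/
abbrev DensityOperator (E : Type) [NormedAddCommGroup E] [InnerProductSpace ℂ E]
    [CompleteSpace E] : Type :=
  {ρ : E →L[ℂ] E // 0 ≤ ρ ∧ opTrace ρ = 1}

/-- The pure state `|e⟩⟨e|` of a unit vector `e`. -/
def pureState {E : Type} [NormedAddCommGroup E] [InnerProductSpace ℂ E] [CompleteSpace E]
    [FiniteDimensional ℂ E] (e : E) (he : ‖e‖ = 1) : DensityOperator E :=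
  ⟨InnerProductSpace.rankOne ℂ e e, by
    constructor
    · rw [ContinuousLinearMap.nonneg_iff_isPositive]
      exact InnerProductSpace.isPositive_rankOne_self e
    · have h : (inner ℂ e e : ℂ) = 1 := by rw [inner_self_eq_norm_sq_to_K, he]; simp
      exact (InnerProductSpace.trace_rankOne e e).trans h⟩

/-! ### Completely positive maps with one Kraus operator -/

theorem exists_eq_star_mul_self {A : Type} [NonUnitalCStarAlgebra A] [PartialOrder A]
    [StarOrderedRing A] (a : A) (h : 0 ≤ a) : ∃ b, a = star b * b :=
  CStarAlgebra.nonneg_iff_eq_star_mul_self.mp h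

/-- `A ↦ V A V†` as a linear map. -/
def conjLin {E F : Type} [NormedAddCommGroup E] [InnerProductSpace ℂ E] [CompleteSpace E]
    [NormedAddCommGroup F] [InnerProductSpace ℂ F] [CompleteSpace F]
    (V : E →L[ℂ] F) : (E →L[ℂ] E) →ₗ[ℂ] (F →L[ℂ] F) where
  toFun A := V ∘L A ∘L ContinuousLinearMap.adjoint V
  map_add' A B := by ext; simp
  map_smul' c A := by ext; simp

theorem cstarMatrix_sum_star_mul_apply {A : Type} [NonUnitalRing A] [StarRing A] {ι : Type}
    [Fintype ι] {k : ℕ} (R : ι → CStarMatrix (Fin k) (Fin k) A) (i j : Fin k) :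
    (∑ s, star (R s) * R s) i j = ∑ s, ∑ l, star (R s l i) * R s l j :=
  (Matrix.sum_apply i j Finset.univ fun s => (star (R s) * R s : Matrix (Fin k) (Fin k) A)).trans
    (Finset.sum_congr rfl fun _ _ => rfl)

theorem cstarMatrix_star_mul_apply {A : Type} [NonUnitalRing A] [StarRing A] {k : ℕ}
    (N : CStarMatrix (Fin k) (Fin k) A) (i j : Fin k) :
    (star N * N) i j = ∑ l, star (N l i) * N l j := rfl

theorem conjLin_star_mul {E F : Type} [NormedAddCommGroup E] [InnerProductSpace ℂ E]
    [FiniteDimensional ℂ E] [CompleteSpace E] [NormedAddCommGroup F] [InnerProductSpace ℂ F]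
    [CompleteSpace F] (V : E →L[ℂ] F) (u : F) (hu : ‖u‖ = 1) (A B : E →L[ℂ] E) :
    conjLin V (star A * B) = ∑ s,
      star (InnerProductSpace.rankOne ℂ u (stdOrthonormalBasis ℂ E s) ∘L A ∘L
        ContinuousLinearMap.adjoint V) *
      (InnerProductSpace.rankOne ℂ u (stdOrthonormalBasis ℂ E s) ∘L B ∘L
        ContinuousLinearMap.adjoint V) := by
  ext x
  refine ext_inner_left ℂ fun y => ?_
  rw [sum_apply, inner_sum]
  change inner ℂ y (V (ContinuousLinearMap.adjoint A (B (ContinuousLinearMap.adjoint V x)))) = _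
  rw [← ContinuousLinearMap.adjoint_inner_left, ContinuousLinearMap.adjoint_inner_right,
    ← (stdOrthonormalBasis ℂ E).sum_inner_mul_inner]
  refine Finset.sum_congr rfl fun s _ => ?_
  rw [mul_apply_eq_comp, ContinuousLinearMap.star_eq_adjoint,
    ContinuousLinearMap.adjoint_inner_right]
  simp [hu, inner_smul_left, inner_smul_right, mul_comm]

/-- The completely positive map `A ↦ V A V†` given by one Kraus operator `V`. -/
def conjCP {E F : Type} [NormedAddCommGroup E] [InnerProductSpace ℂ E] [FiniteDimensional ℂ E]
    [CompleteSpace E] [NormedAddCommGroup F] [InnerProductSpace ℂ F] [CompleteSpace F]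
    (V : E →L[ℂ] F) : (E →L[ℂ] E) →CP (F →L[ℂ] F) where
  toLinearMap := conjLin V
  map_cstarMatrix_nonneg' k M hM := by
    rcases subsingleton_or_nontrivial F with hF | hF
    · have : Subsingleton (F →L[ℂ] F) := ⟨fun A B => by ext x; exact Subsingleton.elim _ _⟩
      exact le_of_eq (Subsingleton.elim _ _)
    obtain ⟨u, hu⟩ : ∃ u : F, ‖u‖ = 1 := by
      obtain ⟨x, hx⟩ := exists_ne (0 : F)
      exact ⟨(‖x‖⁻¹ : ℂ) • x, by simp [norm_smul, hx]⟩
    obtain ⟨N, rfl⟩ := exists_eq_star_mul_self M hM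
    let R : Fin (Module.finrank ℂ E) → CStarMatrix (Fin k) (Fin k) (F →L[ℂ] F) := fun s l j =>
      InnerProductSpace.rankOne ℂ u (stdOrthonormalBasis ℂ E s) ∘L (N l j) ∘L
        ContinuousLinearMap.adjoint V
    have key : (star N * N).map (conjLin V) = ∑ s, star (R s) * R s := by
      refine CStarMatrix.ext fun i j => ?_
      rw [cstarMatrix_sum_star_mul_apply, CStarMatrix.map_apply, cstarMatrix_star_mul_apply,
        map_sum, Finset.sum_comm]
      exact Finset.sum_congr rfl fun l _ => conjLin_star_mul V u hu _ _
    have h : 0 ≤ ∑ s, star (R s) * R s := Finset.sum_nonneg fun s _ => star_mul_self_nonneg _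
    exact key ▸ h

theorem opTrace_conjCP {E F : Type} [NormedAddCommGroup E] [InnerProductSpace ℂ E]
    [FiniteDimensional ℂ E] [CompleteSpace E] [NormedAddCommGroup F] [InnerProductSpace ℂ F]
    [FiniteDimensional ℂ F] [CompleteSpace F] (V : E →L[ℂ] F)
    (hV : ContinuousLinearMap.adjoint V ∘L V = ContinuousLinearMap.id ℂ E) (A : E →L[ℂ] E) :
    opTrace (conjCP V A) = opTrace A := by
  have h : opTrace (conjCP V A) = opTrace (A ∘L (ContinuousLinearMap.adjoint V ∘L V)) :=
    (LinearMap.trace_comp_comm' (V : E →ₗ[ℂ] F)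
      ((A ∘L ContinuousLinearMap.adjoint V : F →L[ℂ] E) : F →ₗ[ℂ] E)).symm
  rw [h, hV]; rfl

theorem adjoint_subtypeL_comp {E : Type} [NormedAddCommGroup E] [InnerProductSpace ℂ E]
    [FiniteDimensional ℂ E] [CompleteSpace E] (W : Submodule ℂ E) :
    ContinuousLinearMap.adjoint W.subtypeL ∘L W.subtypeL = ContinuousLinearMap.id ℂ W := by
  refine ContinuousLinearMap.ext fun x => ext_inner_left ℂ fun y => ?_
  exact ContinuousLinearMap.adjoint_inner_right W.subtypeL y (W.subtypeL x)

/-! ### Quantum variable-length codes -/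

/-- The data of a quantum variable-length code on the Hilbert space `E`: a finite data set `Ω`,
Hilbert spaces `H_ω`, an encoder consisting of completely positive maps
`E_ω : B(E) → B(H_ω)` and a decoder consisting of trace-preserving completely positive maps
`D_ω : B(H_ω) → B(E)`. The normalization of the encoder is `VarLengthCode.IsNormalized`. -/
structure VarLengthCode (E : Type) [NormedAddCommGroup E] [InnerProductSpace ℂ E]
    [CompleteSpace E] where
  Ω : Type
  fintypeΩ : Fintype Ω
  space : Ω → Type
  normedSpace : ∀ ω, NormedAddCommGroup (space ω)
  innerSpace : ∀ ω, InnerProductSpace ℂ (space ω)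
  finDim : ∀ ω, FiniteDimensional ℂ (space ω)
  complete : ∀ ω, CompleteSpace (space ω)
  enc : ∀ ω, (E →L[ℂ] E) →CP (space ω →L[ℂ] space ω)
  dec : ∀ ω, (space ω →L[ℂ] space ω) →CP (E →L[ℂ] E)
  dec_trace : ∀ ω σ, opTrace (dec ω σ) = opTrace σ

attribute [instance] VarLengthCode.fintypeΩ VarLengthCode.normedSpace VarLengthCode.innerSpace
  VarLengthCode.finDim VarLengthCode.complete

section Code

variable {E : Type} [NormedAddCommGroup E] [InnerProductSpace ℂ E] [CompleteSpace E]

/-- `∑_ω Tr E_ω(ρ) = 1` for every density operator `ρ`: the outcome probabilities add up to one. -/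
def VarLengthCode.IsNormalized (C : VarLengthCode E) : Prop :=
  ∀ ρ : DensityOperator E, ∑ ω, opTrace (C.enc ω ρ.1) = 1

/-- The error of decoding
`∑_ω Tr E_ω(ρ) · b²(ρ, D_ω(E_ω(ρ) / Tr E_ω(ρ)))` for the input state `ρ`.
(A term with `Tr E_ω(ρ) = 0` contributes `0`.) -/
def VarLengthCode.error (C : VarLengthCode E) (ρ : E →L[ℂ] E) : ℝ :=
  ∑ ω, (opTrace (C.enc ω ρ)).re *
    bures ρ (C.dec ω ((opTrace (C.enc ω ρ))⁻¹ • C.enc ω ρ)) ^ 2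

end Code

/-! ### The space `(ℂ^d)^{⊗n}` and its Young blocks -/

/-- The space `ℂ^d`. -/
abbrev Sys (d : ℕ) : Type := EuclideanSpace ℂ (Fin d)

/-- The Hilbert space `(ℂ^d)^{⊗n}` in coordinates: the orthonormal product basis
`e_{x₁} ⊗ ⋯ ⊗ e_{xₙ}` is indexed by the words `x : Fin n → Fin d`. -/
abbrev Tens (d n : ℕ) : Type := EuclideanSpace ℂ (Fin n → Fin d)

/-- The tensor product `A₁ ⊗ ⋯ ⊗ Aₙ` of operators on `ℂ^d`; its matrix entries in the product
basis are the products of the entries of the factors. -/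
def tensorOp {d n : ℕ} (A : Fin n → (Sys d →L[ℂ] Sys d)) : Tens d n →L[ℂ] Tens d n :=
  Matrix.toEuclideanCLM (𝕜 := ℂ) (Matrix.of fun x y : Fin n → Fin d =>
    ∏ i, (Matrix.toEuclideanCLM (n := Fin d) (𝕜 := ℂ)).symm (A i) (x i) (y i))

/-- The tensor power `U^{⊗n}` of a matrix. -/
def tensorPow {d : ℕ} (n : ℕ) (U : Matrix (Fin d) (Fin d) ℂ) : Tens d n →L[ℂ] Tens d n :=
  tensorOp fun _ => Matrix.toEuclideanCLM (𝕜 := ℂ) U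

/-- The infinitesimal action `∑ᵢ 1 ⊗ ⋯ ⊗ X ⊗ ⋯ ⊗ 1` (`X` in the `i`-th place). -/
def lieAct {d : ℕ} (n : ℕ) (X : Matrix (Fin d) (Fin d) ℂ) : Tens d n →L[ℂ] Tens d n :=
  ∑ i : Fin n, tensorOp (Function.update (fun _ => ContinuousLinearMap.id ℂ (Sys d)) i
    (Matrix.toEuclideanCLM (𝕜 := ℂ) X))

/-- `N` is invariant under the representation `U ↦ U^{⊗n}` of `SU(d)`. -/
def IsSUInvariant {d n : ℕ} (N : Submodule ℂ (Tens d n)) : Prop :=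
  ∀ U ∈ Matrix.specialUnitaryGroup (Fin d) ℂ, ∀ v ∈ N, tensorPow n U v ∈ N

/-- `N` is an irreducible subrepresentation of the representation of `SU(d)` on
`(ℂ^d)^{⊗n}`. -/
def IsSUIrreducible {d n : ℕ} (N : Submodule ℂ (Tens d n)) : Prop :=
  IsSUInvariant N ∧ N ≠ ⊥ ∧
    ∀ N' : Submodule ℂ (Tens d n), IsSUInvariant N' → N' ≤ N → N' = ⊥ ∨ N' = N

/-- `v` is a highest weight vector of weight `m = (m₁, …, m_d)`: it is non-zero, the diagonal
matrix unit `E_aa` acts on it by `m_a`, and the raising operators `E_ab`, `a < b`, kill it. -/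
def IsHighestWeightVector {d n : ℕ} (m : Fin d → ℕ) (v : Tens d n) : Prop :=
  v ≠ 0 ∧ (∀ a, lieAct n (Matrix.single a a 1) v = (m a : ℂ) • v) ∧
    ∀ a b, a < b → lieAct n (Matrix.single a b 1) v = 0

open Classical in
/-- The set `Y_n` of Young indices `n₁ ≥ ⋯ ≥ n_d`, `∑ nᵢ = n`. -/
def youngIndices (d n : ℕ) : Finset (Fin d → ℕ) :=
  (Finset.piAntidiag Finset.univ n).filter fun m => Antitone m

/-- The Young block `W_m ≅ U_m ⊗ V_m`: the isotypic component of the irreducible representation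
of `SU(d)` with highest weight `m`, that is, the sum of all irreducible subrepresentations of
`(ℂ^d)^{⊗n}` with highest weight `m`. -/
def youngBlock (d n : ℕ) (m : Fin d → ℕ) : Submodule ℂ (Tens d n) :=
  sSup {N | IsSUIrreducible N ∧ ∃ v ∈ N, IsHighestWeightVector m v}

/-- The orthogonal projection `P_m` onto the Young block `W_m`. -/
def youngProj (d n : ℕ) (m : Fin d → ℕ) : Tens d n →L[ℂ] Tens d n :=
  (youngBlock d n m).starProjection

/-! ### The code with parameter `δ` -/

/-- The Euclidean norm on `ℝ^d`. -/
def euclNorm {d : ℕ} (v : Fin d → ℝ) : ℝ := ‖(WithLp.toLp 2 v : EuclideanSpace ℝ (Fin d))‖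

open Classical in
/-- `Y_n ∩ U_{k, nδ}`: the Young indices at Euclidean distance at most `nδ` from `k`. -/
def nearYoung (d : ℕ) (δ : ℝ) (n : ℕ) (k : Fin d → ℤ) : Finset (Fin d → ℕ) :=
  (youngIndices d n).filter fun m : Fin d → ℕ =>
    euclNorm (fun i => (k i : ℝ) - (m i : ℝ)) ≤ n * δ

/-- The data set `Y_{δ,n}`: the integer points `k` with `∑ kᵢ = n` that have a Young index at
distance at most `nδ`. -/
def dataSet (d : ℕ) (δ : ℝ) (n : ℕ) : Set (Fin d → ℤ) :=
  {k | ∑ i, k i = n ∧ (nearYoung d δ n k).Nonempty}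

theorem dataSet_finite (d : ℕ) (δ : ℝ) (n : ℕ) : (dataSet d δ n).Finite := by
  classical
  have h : dataSet d δ n ⊆ ⋃ m ∈ (youngIndices d n : Set (Fin d → ℕ)),
      Set.Icc (fun i => (m i : ℤ) - ⌈(n * δ : ℝ)⌉) (fun i => (m i : ℤ) + ⌈(n * δ : ℝ)⌉) := by
    rintro k ⟨-, m, hm⟩
    simp only [nearYoung, Finset.mem_filter] at hm
    have hi : ∀ i, |(k i : ℝ) - m i| ≤ (⌈(n * δ : ℝ)⌉ : ℝ) := fun i => by
      have h1 := PiLp.norm_apply_le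
        (WithLp.toLp 2 (fun i => (k i : ℝ) - (m i : ℝ)) : EuclideanSpace ℝ (Fin d)) i
      exact (h1.trans hm.2).trans (Int.le_ceil _)
    simp only [Set.mem_iUnion]
    refine ⟨m, hm.1, fun i => ?_, fun i => ?_⟩ <;>
    · have h2 := abs_le.mp (hi i)
      have h3 : -⌈(n * δ : ℝ)⌉ ≤ k i - (m i : ℤ) := by exact_mod_cast h2.1
      have h4 : k i - (m i : ℤ) ≤ ⌈(n * δ : ℝ)⌉ := by exact_mod_cast h2.2
      simp only
      omega
  exact ((youngIndices d n).finite_toSet.biUnion fun m _ => Set.finite_Icc _ _).subset h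

/-- `C_{1,d}(x)`: the number of `k ∈ ℤ^d` with `‖k‖ ≤ x` and `∑ kᵢ = 0`. -/
def ballCount (d : ℕ) (x : ℝ) : ℕ :=
  Set.ncard {k : Fin d → ℤ | euclNorm (fun i => (k i : ℝ)) ≤ x ∧ ∑ i, k i = 0}

/-- `M_k^{δ,n} = (1 / C_{1,d}(nδ)) ∑_{m ∈ Y_n ∩ U_{k,nδ}} P_m`. -/
def effect (d : ℕ) (δ : ℝ) (n : ℕ) (k : Fin d → ℤ) : Tens d n →L[ℂ] Tens d n :=
  ((ballCount d (n * δ) : ℂ)⁻¹) • ∑ m ∈ nearYoung d δ n k, youngProj d n m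

/-- `H_k^{δ,n} = ⨁_{m ∈ Y_n, ‖m - k‖ ≤ nδ} W_m`. -/
def codeSpace (d : ℕ) (δ : ℝ) (n : ℕ) (k : Fin d → ℤ) : Submodule ℂ (Tens d n) :=
  ⨆ m ∈ nearYoung d δ n k, youngBlock d n m

/-- The code `(E^{δ,n}, D^{δ,n})`: the encoder is `E_k(ρ) = √M_k ρ √M_k`, viewed as an operator on
`H_k` (that is, `ι† √M_k ρ √M_k ι` for the inclusion `ι : H_k → (ℂ^d)^{⊗n}`), and the decoder
`D_k(σ) = ι σ ι†` is the embedding of `H_k` into `(ℂ^d)^{⊗n}`. -/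
def youngCode (d : ℕ) (δ : ℝ) (n : ℕ) : VarLengthCode (Tens d n) where
  Ω := dataSet d δ n
  fintypeΩ := (dataSet_finite d δ n).fintype
  space k := codeSpace d δ n k.1
  normedSpace _ := inferInstance
  innerSpace _ := inferInstance
  finDim _ := inferInstance
  complete _ := inferInstance
  enc k := conjCP (ContinuousLinearMap.adjoint (codeSpace d δ n k.1).subtypeL ∘L
    CFC.sqrt (effect d δ n k.1))
  dec k := conjCP (codeSpace d δ n k.1).subtypeL
  dec_trace _ σ := opTrace_conjCP _ (adjoint_subtypeL_comp _) σ

/-! ### Average error and universality -/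

/-- The average error `ε_{n,p}(C) = ∑_{ρ₁,…,ρₙ} p(ρ₁)⋯p(ρₙ) · error(ρ₁ ⊗ ⋯ ⊗ ρₙ)` of a code on
`(ℂ^d)^{⊗n}` for the i.i.d. source with distribution `p` on the density operators. -/
def avgError {d : ℕ} (p : PMF (DensityOperator (Sys d))) (n : ℕ)
    (C : VarLengthCode (Tens d n)) : ℝ :=
  ∑' ρ : Fin n → DensityOperator (Sys d),
    (∏ i, (p (ρ i)).toReal) * C.error (tensorOp fun i => (ρ i).1)

/-- A sequence of codes is universal for a family of sources if its average error tends to `0`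
for every source of the family. -/
def IsUniversal {d : ℕ} (P : Set (PMF (DensityOperator (Sys d))))
    (C : ∀ n, VarLengthCode (Tens d n)) : Prop :=
  ∀ p ∈ P, Tendsto (fun n => avgError p n (C n)) atTop (𝓝 0)

end QuantumSource
end

noncomputable section

namespace QuantumSource

/-! ### Operators on words -/

/-! For a unit vector `v`, outcome `m` of the block measurement has probability `q_m = ‖P_m v‖²`,
and the state left behind has overlap `√q_m` with `v`. The error is therefore `∑ q_m (1 - √q_m) ≥ ½
∑ q_m (1 - q_m)` (`youngCode_error`, `le_youngCode_error`). It is small only if `v` lies almost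
inside one block, and a product of basis vectors in which both letters have positive frequency does
not.

The blocks are separated by `casimir`, the sum of all transpositions of tensor factors. It commutes
with every tensor power, is scalar on each block, and takes different values on different Young
indices. A change of orthonormal basis is a tensor power, so only words in the standard basis have
to be studied.

Let `x` be a word with `k` letters 1, and let `R`, `L` be the raising and lowering operators. By
`casimir_eq`, on the weight space of `x` the operator `L R` is a scalar `a_m` on the part in block
`m`. The moments of `a` under `q` follow from `‖R^j δ_x‖² = j! k (k-1) ⋯ (k-j+1)` for `j ≤ 3`: the
mean is `k`, the variance `D = k (n - k)`, the third central moment `D (n - 2)`. A law almost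
concentrated at one point would have to carry this variance in a far tail, which the third moment
forbids; `le_sum_mul_one_sub` makes this `∑ q_m (1 - q_m) ≥ D / (576 n²)`.

The mean of `k (n - k)` over the source is `(n² - n) p₁ p₂`, so the average error is at least `p₁ p₂
/ 2304` for all `n ≥ 2` (`le_avgError`). -/

theorem toEuclideanCLM_apply_eq_sum {ι : Type} [Fintype ι] [DecidableEq ι] (M : Matrix ι ι ℂ)
    (f : EuclideanSpace ℂ ι) (x : ι) :
    (Matrix.toEuclideanCLM (𝕜 := ℂ) M f) x = ∑ y, M x y * f y := by
  simp [Matrix.ofLp_toEuclideanCLM, Matrix.mulVec, dotProduct]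

theorem tensorOp_apply {d n : ℕ} (A : Fin n → (Sys d →L[ℂ] Sys d)) (f : Tens d n)
    (x : Fin n → Fin d) :
    tensorOp A f x = ∑ y : Fin n → Fin d,
      (∏ i, (Matrix.toEuclideanCLM (n := Fin d) (𝕜 := ℂ)).symm (A i) (x i) (y i)) * f y := by
  rw [tensorOp, toEuclideanCLM_apply_eq_sum]; rfl

theorem tensorPow_apply {d n : ℕ} (U : Matrix (Fin d) (Fin d) ℂ) (f : Tens d n)
    (x : Fin n → Fin d) :
    tensorPow n U f x = ∑ y : Fin n → Fin d, (∏ i, U (x i) (y i)) * f y := by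
  rw [tensorPow, tensorOp_apply]; simp

theorem tensorOp_update_apply {d n : ℕ} (i : Fin n) (X : Matrix (Fin d) (Fin d) ℂ) (f : Tens d n)
    (x : Fin n → Fin d) :
    tensorOp (Function.update (fun _ => ContinuousLinearMap.id ℂ (Sys d)) i
      (Matrix.toEuclideanCLM (𝕜 := ℂ) X)) f x
    = ∑ y : Fin n → Fin d,
      (X (x i) (y i) * ∏ j ∈ Finset.univ.erase i, (1 : Matrix (Fin d) (Fin d) ℂ) (x j) (y j))
        * f y := by
  rw [tensorOp_apply]
  refine Finset.sum_congr rfl fun y _ => ?_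
  congr 1
  rw [← Finset.mul_prod_erase _ _ (Finset.mem_univ i)]
  congr 1
  · simp
  · refine Finset.prod_congr rfl fun j hj => ?_
    rw [Function.update_of_ne (Finset.ne_of_mem_erase hj)]
    have : ContinuousLinearMap.id ℂ (Sys d) = Matrix.toEuclideanCLM (n := Fin d) (𝕜 := ℂ) 1 := by
      rw [map_one]; rfl
    rw [this]; simp

theorem tensorOp_update_apply' {d n : ℕ} (i : Fin n) (X : Matrix (Fin d) (Fin d) ℂ) (f : Tens d n)
    (x : Fin n → Fin d) :
    tensorOp (Function.update (fun _ => ContinuousLinearMap.id ℂ (Sys d)) i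
      (Matrix.toEuclideanCLM (𝕜 := ℂ) X)) f x
    = ∑ b, X (x i) b * f (Function.update x i b) := by
  rw [tensorOp_update_apply]
  symm
  refine Finset.sum_of_injOn (fun b => Function.update x i b) ?_ (by simp) ?_ ?_
  · intro b _ b' _ h
    simpa using congrFun h i
  · intro y _ hy
    have : ∃ j, j ≠ i ∧ x j ≠ y j := by
      by_contra! h
      refine hy ⟨y i, by simp, ?_⟩
      ext j
      by_cases hj : j = i
      · subst hj; simp
      · simp [hj, h j hj]
    obtain ⟨j, hj, hxy⟩ := this
    rw [Finset.prod_eq_zero (i := j) (by simp [hj]) (by simp [hxy])]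
    simp
  · intro b _
    simp only [Function.update_self]
    rw [Finset.prod_eq_one, mul_one]
    intro j hj
    rw [Function.update_of_ne (Finset.ne_of_mem_erase hj)]; simp

theorem lieAct_apply {d n : ℕ} (X : Matrix (Fin d) (Fin d) ℂ) (f : Tens d n)
    (x : Fin n → Fin d) :
    lieAct n X f x = ∑ i, ∑ b, X (x i) b * f (Function.update x i b) := by
  simp [lieAct, sum_apply, tensorOp_update_apply']

theorem lieAct_single_apply {d n : ℕ} (a b : Fin d) (f : Tens d n) (x : Fin n → Fin d) :
    lieAct n (Matrix.single a b 1) f x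
      = ∑ i, if x i = a then f (Function.update x i b) else 0 := by
  rw [lieAct_apply]
  refine Finset.sum_congr rfl fun i _ => ?_
  rw [Finset.sum_eq_single b]
  · by_cases h : x i = a
    · simp [h]
    · simp [h, Ne.symm h]
  · intro c _ hc
    simp [hc.symm]
  · simp

/-- The number of occurrences of the letter `a` in the word `x`. -/
def letterCount {d n : ℕ} (a : Fin d) (x : Fin n → Fin d) : ℕ :=
  (Finset.univ.filter fun i => x i = a).card

theorem lieAct_diag_apply {d n : ℕ} (a : Fin d) (f : Tens d n) (x : Fin n → Fin d) :
    lieAct n (Matrix.single a a 1) f x = letterCount a x * f x := by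
  rw [lieAct_single_apply]
  have : ∀ i, (if x i = a then f (Function.update x i a) else 0) = if x i = a then f x else 0 := by
    intro i
    split_ifs with h
    · rw [← h, Function.update_eq_self]
    · rfl
  simp [this, letterCount, ← Finset.sum_filter]

theorem lieAct_add {d n : ℕ} (X Y : Matrix (Fin d) (Fin d) ℂ) :
    lieAct n (X + Y) = lieAct n X + lieAct n Y := by
  ext f x
  simp [lieAct_apply, add_mul, Finset.sum_add_distrib]

theorem lieAct_smul {d n : ℕ} (c : ℂ) (X : Matrix (Fin d) (Fin d) ℂ) :
    lieAct n (c • X) = c • lieAct n X := by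
  ext f x
  simp [lieAct_apply, Finset.mul_sum, mul_assoc]

/-- The permutation of the tensor factors by `σ`. -/
def permOp {d n : ℕ} (σ : Equiv.Perm (Fin n)) : Tens d n →L[ℂ] Tens d n :=
  LinearMap.toContinuousLinearMap
    { toFun := fun f => WithLp.toLp 2 fun x => f (x ∘ σ)
      map_add' := fun f g => by ext; simp
      map_smul' := fun c f => by ext; simp }

@[simp]
theorem permOp_apply {d n : ℕ} (σ : Equiv.Perm (Fin n)) (f : Tens d n) (x : Fin n → Fin d) :
    permOp σ f x = f (x ∘ σ) := rfl

/-- The sum of all `permOp (swap i j)`, the Casimir operator up to normalization. -/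
def casimir (d n : ℕ) : Tens d n →L[ℂ] Tens d n :=
  ∑ i : Fin n, ∑ j : Fin n, permOp (Equiv.swap i j)

theorem casimir_apply {d n : ℕ} (f : Tens d n) (x : Fin n → Fin d) :
    casimir d n f x = ∑ i : Fin n, ∑ j : Fin n, f (x ∘ Equiv.swap i j) := by
  simp [casimir, sum_apply]

/-! ### Commutation relations, adjoints and products -/

theorem inner_tens {d n : ℕ} (f g : Tens d n) :
    inner ℂ f g = ∑ x, (starRingEnd ℂ) (f x) * g x := by
  simp [PiLp.inner_apply, mul_comm]

theorem permOp_comm_tensorPow {d n : ℕ} (σ : Equiv.Perm (Fin n)) (U : Matrix (Fin d) (Fin d) ℂ)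
    (f : Tens d n) : permOp σ (tensorPow n U f) = tensorPow n U (permOp σ f) := by
  ext x
  rw [permOp_apply, tensorPow_apply, tensorPow_apply]
  refine (Fintype.sum_equiv (Equiv.arrowCongr σ (Equiv.refl (Fin d))) _ _ fun y => ?_).trans rfl
  rw [permOp_apply]
  congr 1
  · refine Fintype.prod_equiv σ _ _ fun i => ?_
    simp
  · refine congrArg f (funext fun i => ?_); simp

theorem permOp_comm_lieAct {d n : ℕ} (σ : Equiv.Perm (Fin n)) (X : Matrix (Fin d) (Fin d) ℂ)
    (f : Tens d n) : permOp σ (lieAct n X f) = lieAct n X (permOp σ f) := by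
  ext x
  rw [permOp_apply, lieAct_apply, lieAct_apply]
  refine Fintype.sum_equiv σ _ _ fun i => ?_
  refine Finset.sum_congr rfl fun b _ => ?_
  rw [permOp_apply, Function.update_comp_equiv]
  simp

theorem casimir_comm_tensorPow {d n : ℕ} (U : Matrix (Fin d) (Fin d) ℂ) (f : Tens d n) :
    casimir d n (tensorPow n U f) = tensorPow n U (casimir d n f) := by
  simp [casimir, sum_apply, permOp_comm_tensorPow, map_sum]

theorem casimir_comm_lieAct {d n : ℕ} (X : Matrix (Fin d) (Fin d) ℂ) (f : Tens d n) :
    casimir d n (lieAct n X f) = lieAct n X (casimir d n f) := by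
  simp [casimir, sum_apply, permOp_comm_lieAct, map_sum]

theorem inner_permOp_left {d n : ℕ} (σ : Equiv.Perm (Fin n)) (f g : Tens d n) :
    inner ℂ (permOp σ f) g = inner ℂ f (permOp σ⁻¹ g) := by
  rw [inner_tens, inner_tens]
  refine Fintype.sum_equiv (Equiv.arrowCongr σ⁻¹ (Equiv.refl (Fin d))) _ _ fun y => ?_
  rw [permOp_apply, permOp_apply]
  congr 1
  refine congrArg g (funext fun i => ?_)
  change y i = y (σ (σ.symm i))
  simp

theorem inner_casimir_left {d n : ℕ} (f g : Tens d n) :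
    inner ℂ (casimir d n f) g = inner ℂ f (casimir d n g) := by
  simp [casimir, sum_apply, inner_permOp_left]

theorem inner_tensorPow_left {d n : ℕ} (U : Matrix (Fin d) (Fin d) ℂ) (f g : Tens d n) :
    inner ℂ (tensorPow n U f) g = inner ℂ f (tensorPow n (star U) g) := by
  simp only [inner_tens, tensorPow_apply, map_sum, Finset.sum_mul, Finset.mul_sum, map_mul,
    map_prod, Matrix.star_apply]
  rw [Finset.sum_comm]
  refine Finset.sum_congr rfl fun x _ => Finset.sum_congr rfl fun y _ => ?_
  simp only [RCLike.star_def]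
  ring

theorem inner_lieAct_left {d n : ℕ} (X : Matrix (Fin d) (Fin d) ℂ) (f g : Tens d n) :
    inner ℂ (lieAct n X f) g = inner ℂ f (lieAct n (star X) g) := by
  simp only [lieAct, sum_apply, sum_inner, inner_sum]
  refine Finset.sum_congr rfl fun i _ => ?_
  simp only [inner_tens, tensorOp_update_apply, map_sum, Finset.sum_mul, Finset.mul_sum, map_mul,
    map_prod, Matrix.star_apply]
  rw [Finset.sum_comm]
  refine Finset.sum_congr rfl fun x _ => Finset.sum_congr rfl fun y _ => ?_
  have : ∀ j, (starRingEnd ℂ) ((1 : Matrix (Fin d) (Fin d) ℂ) (y j) (x j))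
      = (1 : Matrix (Fin d) (Fin d) ℂ) (x j) (y j) := by
    intro j
    rw [Matrix.one_apply, Matrix.one_apply, apply_ite (starRingEnd ℂ), map_one, map_zero]
    simp only [eq_comm]
  simp only [RCLike.star_def, this]
  ring

theorem inner_lieAct_single_left {d n : ℕ} (a b : Fin d) (f g : Tens d n) :
    inner ℂ (lieAct n (Matrix.single a b 1) f) g
      = inner ℂ f (lieAct n (Matrix.single b a 1) g) := by
  rw [inner_lieAct_left, Matrix.star_eq_conjTranspose, Matrix.conjTranspose_single, star_one]

theorem tensorPow_mul_apply {d n : ℕ} (U V : Matrix (Fin d) (Fin d) ℂ) (f : Tens d n) :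
    tensorPow n (U * V) f = tensorPow n U (tensorPow n V f) := by
  ext x
  simp only [tensorPow_apply, Matrix.mul_apply, Finset.mul_sum]
  rw [Finset.sum_comm]
  refine Finset.sum_congr rfl fun z _ => ?_
  rw [Finset.prod_univ_sum, Fintype.piFinset_univ, Finset.sum_mul]
  refine Finset.sum_congr rfl fun y _ => ?_
  rw [Finset.prod_mul_distrib, mul_assoc]

theorem tensorPow_one_apply {d n : ℕ} (f : Tens d n) : tensorPow n 1 f = f := by
  ext x
  rw [tensorPow_apply, Finset.sum_eq_single x]
  · simp
  · intro y _ hy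
    obtain ⟨j, hj⟩ := Function.ne_iff.mp hy
    rw [Finset.prod_eq_zero (Finset.mem_univ j) (by simp [hj.symm]), zero_mul]
  · simp

/-! ### Transpositions in terms of raising, lowering and letter counts -/

theorem letterCount_zero_add_one {n : ℕ} (x : Fin n → Fin 2) :
    letterCount 0 x + letterCount 1 x = n := by
  have h : ∀ i, (x i = 1) ↔ ¬ (x i = 0) := fun i => by
    generalize x i = c; fin_cases c <;> simp
  have := Finset.card_filter_add_card_filter_not (s := (Finset.univ : Finset (Fin n)))
    (fun i => x i = 0)
  simpa [letterCount, h] using this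

theorem comp_swap_eq_update {d n : ℕ} (x : Fin n → Fin d) (i j : Fin n) :
    x ∘ Equiv.swap i j = Function.update (Function.update x i (x j)) j (x i) := by
  ext k
  by_cases hj : k = j
  · subst hj; simp
  · by_cases hi : k = i
    · subst hi; simp [hj]
    · simp [hi, hj, Equiv.swap_apply_of_ne_of_ne hi hj]

theorem comp_swap_eq_self {d n : ℕ} (x : Fin n → Fin d) {i j : Fin n} (h : x i = x j) :
    x ∘ Equiv.swap i j = x := by
  rw [comp_swap_eq_update, ← h, Function.update_eq_self, h, Function.update_eq_self]

/-- The two single-letter changes either hit the same place and cancel, which gives the letter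
count, or hit two places with different letters, which amounts to a transposition. -/
theorem lieAct_single_lieAct_single_apply {d n : ℕ} {a b : Fin d} (hab : a ≠ b) (f : Tens d n)
    (x : Fin n → Fin d) :
    lieAct n (Matrix.single b a 1) (lieAct n (Matrix.single a b 1) f) x
      = letterCount b x * f x
        + ∑ i, ∑ j, if x i = b ∧ x j = a then f (x ∘ Equiv.swap i j) else 0 := by
  rw [← lieAct_diag_apply, lieAct_single_apply, lieAct_single_apply, ← Finset.sum_add_distrib]
  refine Finset.sum_congr rfl fun i _ => ?_
  by_cases hi : x i = b
  · simp only [hi, if_true, true_and]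
    rw [lieAct_single_apply, ← Finset.add_sum_erase _ _ (Finset.mem_univ i),
      ← Finset.add_sum_erase (a := i) _ (fun j => if x j = a then _ else _) (Finset.mem_univ i)]
    have h1 : ¬ (b = a) := fun h => hab h.symm
    simp only [hi, h1, if_false, zero_add, Function.update_self, if_true, Function.update_idem]
    congr 1
    refine Finset.sum_congr rfl fun j hj => ?_
    have hj' := Finset.ne_of_mem_erase hj
    rw [Function.update_of_ne hj']
    split_ifs with h
    · rw [comp_swap_eq_update, h, hi]
    · rfl
  · simp [hi]

/-- Pairs of places with equal letters, `i = j` included, fix `x` and give the two squares. A mixed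
pair occurs in both orders, hence the factor 2; the term `-2 * letterCount b x` removes the diagonal
part of the operator product. -/
theorem casimir_eq {n : ℕ} {a b : Fin 2} (hab : a ≠ b) (f : Tens 2 n) (x : Fin n → Fin 2) :
    casimir 2 n f x = 2 * lieAct n (Matrix.single b a 1) (lieAct n (Matrix.single a b 1) f) x
      + ((letterCount a x : ℂ) ^ 2 + (letterCount b x : ℂ) ^ 2 - 2 * letterCount b x) * f x := by
  rw [lieAct_single_lieAct_single_apply hab, casimir_apply]
  have hab' : ∀ c : Fin 2, c = a ∨ c = b := by omega
  have key : ∀ i j : Fin n, f (x ∘ Equiv.swap i j)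
      = (if x i = b ∧ x j = a then f (x ∘ Equiv.swap i j) else 0)
        + (if x j = b ∧ x i = a then f (x ∘ Equiv.swap j i) else 0)
        + (if x i = a then 1 else 0) * (if x j = a then 1 else 0) * f x
        + (if x i = b then 1 else 0) * (if x j = b then 1 else 0) * f x := by
    intro i j
    rcases hab' (x i) with hi | hi <;> rcases hab' (x j) with hj | hj <;>
      simp [hi, hj, hab, hab.symm, Equiv.swap_comm i j]
    · rw [← Equiv.swap_comm, comp_swap_eq_self x (hi.trans hj.symm)]
    · rw [← Equiv.swap_comm, comp_swap_eq_self x (hi.trans hj.symm)]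
  have hc : ∀ c : Fin 2, (∑ i, if x i = c then (1 : ℂ) else 0) = letterCount c x := fun c => by
    simp [letterCount]
  simp_rw [Finset.sum_congr rfl fun i _ => Finset.sum_congr rfl fun j _ => key i j]
  simp only [Finset.sum_add_distrib, ← Finset.sum_mul, ← Finset.mul_sum, hc]
  rw [Finset.sum_comm (f := fun i j => if x j = b ∧ x i = a then f (x ∘ Equiv.swap j i) else 0)]
  ring

/-! ### From `SU(2)` to its Lie algebra -/

/-- Since `X² = -1`, this matrix is `exp(tX)`. In the determinant the cross term `cos t · sin t`
carries the trace of `X`, which is zero. -/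
theorem cos_add_sin_mem_specialUnitaryGroup {X : Matrix (Fin 2) (Fin 2) ℂ} (hsq : X * X = -1)
    (hstar : star X = -X) (htr : X 1 1 = -X 0 0) (hdet : X.det = 1) (t : ℝ) :
    (Real.cos t : ℂ) • (1 : Matrix (Fin 2) (Fin 2) ℂ) + (Real.sin t : ℂ) • X
      ∈ Matrix.specialUnitaryGroup (Fin 2) ℂ := by
  have hcs : (Real.cos t : ℂ) ^ 2 + (Real.sin t : ℂ) ^ 2 = 1 := by
    exact_mod_cast Real.cos_sq_add_sin_sq t
  rw [Matrix.mem_specialUnitaryGroup_iff]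
  constructor
  · rw [Matrix.mem_unitaryGroup_iff', star_add, star_smul, star_smul, hstar, star_one]
    simp only [RCLike.star_def, Complex.conj_ofReal, add_mul, mul_add, smul_mul_assoc,
      mul_smul_comm, one_mul, mul_one, neg_mul, hsq, smul_neg, neg_neg]
    trans ((Real.cos t : ℂ) ^ 2 + (Real.sin t : ℂ) ^ 2) • (1 : Matrix (Fin 2) (Fin 2) ℂ)
    · module
    · rw [hcs, one_smul]
  · rw [Matrix.det_fin_two] at hdet ⊢
    simp only [Matrix.add_apply, Matrix.smul_apply, smul_eq_mul, Matrix.one_apply_eq, htr, ne_eq,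
      zero_ne_one, one_ne_zero, not_false_eq_true, Matrix.one_apply_ne] at hdet ⊢
    linear_combination (Real.sin t : ℂ) ^ 2 * hdet + hcs

theorem lieAct_mem_of_isSUInvariant {n : ℕ} {N : Submodule ℂ (Tens 2 n)} (hN : IsSUInvariant N)
    {X : Matrix (Fin 2) (Fin 2) ℂ} (hsq : X * X = -1)
    (hstar : star X = -X) (htr : X 1 1 = -X 0 0) (hdet : X.det = 1) {v : Tens 2 n} (hv : v ∈ N) :
    lieAct n X v ∈ N := by
  -- As `N = Nᗮᗮ`, it suffices to test against `w ∈ Nᗮ`. The scalar function `t ↦ ⟪w, U(t)^{⊗n} v⟫`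
  -- vanishes identically, and its derivative at 0 is `⟪w, lieAct n X v⟫`.
  rw [← Submodule.orthogonal_orthogonal N, Submodule.mem_orthogonal]
  intro w hw
  set U : ℝ → Matrix (Fin 2) (Fin 2) ℂ := fun t => (Real.cos t : ℂ) • 1 + (Real.sin t : ℂ) • X
  have h0 : ∀ t : ℝ, inner ℂ w (tensorPow n (U t) v) = 0 := fun t =>
    (Submodule.mem_orthogonal' _ _).mp hw _
      (hN _ (cos_add_sin_mem_specialUnitaryGroup hsq hstar htr hdet t) v hv)
  have hU : ∀ a b, HasDerivAt (fun t => U t a b) (X a b) 0 := by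
    intro a b
    have hc : HasDerivAt (fun t : ℝ => (Real.cos t : ℂ)) 0 0 := by
      simpa using (Real.hasDerivAt_cos 0).ofReal_comp
    have hs : HasDerivAt (fun t : ℝ => (Real.sin t : ℂ)) 1 0 := by
      simpa using (Real.hasDerivAt_sin 0).ofReal_comp
    simpa [U] using (hc.mul_const ((1 : Matrix (Fin 2) (Fin 2) ℂ) a b)).fun_add
      (hs.mul_const (X a b))
  have hU0 : U 0 = 1 := by simp [U]
  have hd : HasDerivAt (fun t => inner ℂ w (tensorPow n (U t) v)) (inner ℂ w (lieAct n X v)) 0 := by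
    simp only [inner_tens, tensorPow_apply, lieAct, sum_apply]
    refine HasDerivAt.fun_sum fun x _ => HasDerivAt.const_mul _ ?_
    have : ∀ i, tensorOp (Function.update (fun _ => ContinuousLinearMap.id ℂ (Sys 2)) i
      (Matrix.toEuclideanCLM (𝕜 := ℂ) X)) v x = _ := fun i => tensorOp_update_apply i X v x
    simp only [WithLp.ofLp_sum, Finset.sum_apply, this]
    rw [Finset.sum_comm]
    refine HasDerivAt.fun_sum fun y _ => ?_
    rw [← Finset.sum_mul]
    refine HasDerivAt.mul_const ?_ _
    -- At `t = 0` the undifferentiated factors are entries of the identity, as in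
    -- `tensorOp_update_apply`.
    have := HasDerivAt.fun_finsetProd (u := Finset.univ) (x := (0 : ℝ))
      (f := fun i t => U t (x i) (y i)) (f' := fun i => X (x i) (y i))
      fun i _ => hU (x i) (y i)
    simpa [hU0, smul_eq_mul, mul_comm] using this
  have h1 : HasDerivAt (fun t => inner ℂ w (tensorPow n (U t) v)) 0 0 := by
    simp only [h0]; exact hasDerivAt_const _ _
  exact hd.unique h1

theorem lieAct_raising_mem {n : ℕ} {N : Submodule ℂ (Tens 2 n)} (hN : IsSUInvariant N)
    {v : Tens 2 n} (hv : v ∈ N) : lieAct n (Matrix.single 0 1 1) v ∈ N := by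
  have hJ := lieAct_mem_of_isSUInvariant hN (X := !![0, 1; -1, 0])
    (by ext i j; fin_cases i <;> fin_cases j <;> simp [Matrix.mul_apply])
    (by ext i j; fin_cases i <;> fin_cases j <;> simp) (by simp) (by simp [Matrix.det_fin_two]) hv
  have hK := lieAct_mem_of_isSUInvariant hN (X := !![0, Complex.I; Complex.I, 0])
    (by ext i j; fin_cases i <;> fin_cases j <;> simp [Matrix.mul_apply])
    (by ext i j; fin_cases i <;> fin_cases j <;> simp) (by simp) (by simp [Matrix.det_fin_two]) hv
  have : (Matrix.single 0 1 1 : Matrix (Fin 2) (Fin 2) ℂ)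
      = (1 / 2 : ℂ) • !![0, 1; -1, 0] + (-Complex.I / 2) • !![0, Complex.I; Complex.I, 0] := by
    ext i j
    fin_cases i <;> fin_cases j <;> simp <;> ring_nf <;> simp <;> norm_num
  rw [this, lieAct_add, lieAct_smul, lieAct_smul]
  exact N.add_mem (N.smul_mem _ hJ) (N.smul_mem _ hK)

theorem lieAct_one {d n : ℕ} (v : Tens d n) : lieAct n 1 v = (n : ℂ) • v := by
  ext x
  rw [lieAct_apply]
  simp [Matrix.one_apply]

/-- `E₀₀` has trace 1, so it is not in the complexified Lie algebra of `SU(2)`; its scalar part is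
harmless because the identity acts as multiplication by `n`. -/
theorem lieAct_diag_mem {n : ℕ} {N : Submodule ℂ (Tens 2 n)} (hN : IsSUInvariant N)
    {v : Tens 2 n} (hv : v ∈ N) : lieAct n (Matrix.single 0 0 1) v ∈ N := by
  have hK := lieAct_mem_of_isSUInvariant hN (X := !![Complex.I, 0; 0, -Complex.I])
    (by ext i j; fin_cases i <;> fin_cases j <;> simp [Matrix.mul_apply])
    (by ext i j; fin_cases i <;> fin_cases j <;> simp) (by simp) (by simp [Matrix.det_fin_two]) hv
  have : (Matrix.single 0 0 1 : Matrix (Fin 2) (Fin 2) ℂ)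
      = (1 / 2 : ℂ) • 1 + (-Complex.I / 2) • !![Complex.I, 0; 0, -Complex.I] := by
    ext i j
    fin_cases i <;> fin_cases j <;> simp <;> ring_nf <;> simp <;> norm_num
  rw [this, lieAct_add, lieAct_smul, lieAct_smul]
  refine N.add_mem (N.smul_mem _ ?_) (N.smul_mem _ hK)
  change lieAct n 1 v ∈ N
  rw [lieAct_one]
  exact N.smul_mem _ hv

/-! ### Highest weight vectors -/

theorem letterCount_update {d n : ℕ} {x : Fin n → Fin d} {i : Fin n} {a b : Fin d} (hi : x i = a)
    (hab : a ≠ b) : letterCount a x = letterCount a (Function.update x i b) + 1 := by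
  have : (Finset.univ.filter fun j => x j = a)
      = insert i (Finset.univ.filter fun j => Function.update x i b j = a) := by
    ext j
    by_cases hj : j = i
    · subst hj; simp [hi]
    · simp [hj]
  rw [letterCount, this, Finset.card_insert_of_notMem (by simp [hab.symm])]
  rfl

theorem exists_weightVector {n : ℕ} {N : Submodule ℂ (Tens 2 n)} (hN : IsSUInvariant N)
    (hne : N ≠ ⊥) : ∃ v ∈ N, v ≠ 0 ∧ ∃ k : ℕ, ∀ x, v x ≠ 0 → letterCount 0 x = k := by
  have : Nontrivial N := Submodule.nontrivial_iff_ne_bot.mpr hne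
  let T : Module.End ℂ N := (lieAct n (Matrix.single (0 : Fin 2) 0 1)).toLinearMap.restrict
    fun v hv => by exact lieAct_diag_mem hN hv
  obtain ⟨μ, hμ⟩ := Module.End.exists_eigenvalue T
  obtain ⟨v, hv⟩ := hμ.exists_hasEigenvector
  have hv0 : (v : Tens 2 n) ≠ 0 := fun h => hv.2 (Subtype.ext h)
  have hTv : lieAct n (Matrix.single 0 0 1) (v : Tens 2 n) = μ • (v : Tens 2 n) :=
    congrArg Subtype.val hv.apply_eq_smul
  have hx : ∀ x, (v : Tens 2 n) x ≠ 0 → (letterCount 0 x : ℂ) = μ := by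
    intro x hx
    have := congrArg (fun f : Tens 2 n => f x) hTv
    simp only [lieAct_diag_apply, PiLp.smul_apply, smul_eq_mul] at this
    exact mul_right_cancel₀ hx this
  obtain ⟨x, hx0⟩ : ∃ x, (v : Tens 2 n) x ≠ 0 := by
    by_contra! h
    exact hv0 (by ext x; exact h x)
  refine ⟨v, v.2, hv0, letterCount 0 x, fun y hy => ?_⟩
  exact_mod_cast (hx y hy).trans (hx x hx0).symm

/-- The value of the Casimir operator on highest weight vectors of weight `m`. -/
def casimirValue (m : Fin 2 → ℕ) : ℝ := (m 0 : ℝ) ^ 2 + (m 1 : ℝ) ^ 2 - 2 * m 1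

theorem IsHighestWeightVector.casimir_eq {n : ℕ} {m : Fin 2 → ℕ} {v : Tens 2 n}
    (hv : IsHighestWeightVector m v) : casimir 2 n v = (casimirValue m : ℂ) • v := by
  ext x
  have h : ∀ a, (letterCount a x : ℂ) * v x = m a * v x := fun a => by
    simpa [lieAct_diag_apply] using congrArg (fun f : Tens 2 n => f x) (hv.2.1 a)
  rw [QuantumSource.casimir_eq (a := 0) (b := 1) (by decide), hv.2.2 0 1 (by decide)]
  simp only [map_zero, PiLp.zero_apply, PiLp.smul_apply, smul_eq_mul, casimirValue]
  push_cast
  linear_combination ((letterCount 0 x : ℂ) + m 0) * h 0 + ((letterCount 1 x : ℂ) + m 1 - 2) * h 1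

/-- A weight vector of `N` with the largest possible number `k` of letters 0 must be killed by
raising. The ordering `n - k ≤ k` comes from `‖L v‖² = (k - (n - k)) ‖v‖² ≥ 0`. -/
theorem exists_isHighestWeightVector {n : ℕ} {N : Submodule ℂ (Tens 2 n)} (hN : IsSUInvariant N)
    (hne : N ≠ ⊥) : ∃ m ∈ youngIndices 2 n, ∃ v ∈ N, IsHighestWeightVector m v := by
  let p : ℕ → Prop := fun k => ∃ v ∈ N, v ≠ 0 ∧ ∀ x, v x ≠ 0 → letterCount 0 x = k
  have hp : ∃ k, p k := by
    obtain ⟨v, hv, h0, k, hk⟩ := exists_weightVector hN hne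
    exact ⟨k, v, hv, h0, hk⟩
  have hle : ∀ k, p k → k ≤ n := by
    rintro k ⟨v, -, h0, hk⟩
    obtain ⟨x, hx0⟩ : ∃ x, v x ≠ 0 := by
      by_contra! h
      exact h0 (by ext x; exact h x)
    have := letterCount_zero_add_one x
    rw [hk x hx0] at this
    omega
  obtain ⟨k, hpk, hmax⟩ : ∃ k, p k ∧ ¬ p (k + 1) := by
    by_contra! h
    obtain ⟨k, hk⟩ := hp
    have : ∀ j, p (k + j) := fun j => by
      induction j with
      | zero => exact hk
      | succ j ih => exact h _ ih
    have := hle _ (this (n + 1))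
    omega
  have hkn := hle k hpk
  obtain ⟨v, hvN, hv0, hv⟩ := hpk
  have hR : lieAct n (Matrix.single 0 1 1) v = 0 := by
    by_contra h
    refine hmax ⟨_, lieAct_raising_mem hN hvN, h, fun x hx => ?_⟩
    rw [lieAct_single_apply] at hx
    obtain ⟨i, -, hi⟩ := Finset.exists_ne_zero_of_sum_ne_zero hx
    have hxi : x i = 0 := by
      by_contra h; simp [h] at hi
    rw [if_pos hxi] at hi
    rw [letterCount_update hxi (b := 1) (by decide), hv _ hi]
  have hw : ∀ x, (letterCount 0 x : ℂ) * v x = k * v x := fun x => by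
    by_cases hx : v x = 0
    · simp [hx]
    · rw [hv x hx]
  have hw1 : ∀ x, (letterCount 1 x : ℂ) * v x = (n - k : ℕ) * v x := fun x => by
    have h1 : (letterCount 0 x : ℂ) + letterCount 1 x = n := by
      exact_mod_cast letterCount_zero_add_one x
    push_cast [Nat.cast_sub hkn]
    linear_combination v x * h1 - hw x
  have hwt : IsHighestWeightVector ![k, n - k] v := by
    refine ⟨hv0, fun a => ?_, fun a b hab => ?_⟩
    · ext x
      rw [lieAct_diag_apply]
      fin_cases a
      · simpa using hw x
      · simpa using hw1 x
    · obtain ⟨rfl, rfl⟩ : a = 0 ∧ b = 1 := by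
        revert a b; decide
      exact hR
  refine ⟨_, ?_, v, hvN, hwt⟩
  -- `casimir_eq` with the letters exchanged expresses `R L`; subtracting the known Casimir value
  -- leaves `k - (n - k)`.
  have hRL : lieAct n (Matrix.single 0 1 1) (lieAct n (Matrix.single 1 0 1) v)
      = (((k : ℝ) - (n - k : ℕ) : ℝ) : ℂ) • v := by
    ext x
    have h1 := congrArg (fun f : Tens 2 n => f x) hwt.casimir_eq
    simp only [PiLp.smul_apply, smul_eq_mul] at h1
    rw [QuantumSource.casimir_eq (a := 1) (b := 0) (by decide)] at h1
    simp only [casimirValue, Matrix.cons_val_zero, Matrix.cons_val_one, PiLp.smul_apply,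
      smul_eq_mul] at h1 ⊢
    push_cast at h1 ⊢
    linear_combination h1 / 2 - ((letterCount 0 x : ℂ) + k - 2) / 2 * hw x
      - ((letterCount 1 x : ℂ) + (n - k : ℕ)) / 2 * hw1 x
  have hnn : (0 : ℝ) ≤ ((k : ℝ) - (n - k : ℕ)) * ‖v‖ ^ 2 := by
    have h1 := inner_lieAct_single_left (n := n) 1 0 v (lieAct n (Matrix.single 1 0 1) v)
    rw [hRL, inner_smul_right, inner_self_eq_norm_sq_to_K, inner_self_eq_norm_sq_to_K] at h1
    have h2 : ‖lieAct n (Matrix.single 1 0 1) v‖ ^ 2 = ((k : ℝ) - (n - k : ℕ)) * ‖v‖ ^ 2 := by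
      refine Complex.ofReal_injective ?_
      rw [Complex.ofReal_mul, Complex.ofReal_pow, Complex.ofReal_pow]
      exact h1
    rw [← h2]; positivity
  have hk2 : n - k ≤ k := by
    have := nonneg_of_mul_nonneg_left hnn (by positivity)
    have : ((n - k : ℕ) : ℝ) ≤ k := by linarith
    exact_mod_cast this
  simp only [youngIndices, Finset.mem_filter, Finset.mem_piAntidiag, Finset.mem_univ]
  refine ⟨⟨?_, by simp⟩, ?_⟩
  · rw [Fin.sum_univ_two]; simp; omega
  · intro a b hab
    fin_cases a <;> fin_cases b <;> simp_all

/-! ### The decomposition into Young blocks -/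

theorem mem_specialUnitaryGroup_star {d : ℕ} {U : Matrix (Fin d) (Fin d) ℂ}
    (hU : U ∈ Matrix.specialUnitaryGroup (Fin d) ℂ) :
    star U ∈ Matrix.specialUnitaryGroup (Fin d) ℂ := by
  rw [Matrix.mem_specialUnitaryGroup_iff] at hU ⊢
  refine ⟨Unitary.star_mem hU.1, ?_⟩
  rw [Matrix.star_eq_conjTranspose, Matrix.det_conjTranspose, hU.2, star_one]

theorem IsSUInvariant.orthogonal {d n : ℕ} {N : Submodule ℂ (Tens d n)} (hN : IsSUInvariant N) :
    IsSUInvariant Nᗮ := by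
  intro U hU v hv
  rw [Submodule.mem_orthogonal'] at hv ⊢
  intro u hu
  rw [inner_tensorPow_left]
  exact hv _ (hN _ (mem_specialUnitaryGroup_star hU) u hu)

theorem isSUInvariant_sSup {d n : ℕ} {s : Set (Submodule ℂ (Tens d n))}
    (hs : ∀ N ∈ s, IsSUInvariant N) : IsSUInvariant (sSup s) := by
  intro U hU v hv
  have : sSup s ≤ (sSup s).comap (tensorPow n U).toLinearMap :=
    sSup_le fun N hN w hw => (le_sSup hN : N ≤ sSup s) (hs N hN U hU w hw)
  exact this hv

theorem exists_isSUIrreducible_le {d n : ℕ} {N : Submodule ℂ (Tens d n)} (hN : IsSUInvariant N)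
    (hne : N ≠ ⊥) : ∃ N' ≤ N, IsSUIrreducible N' := by
  obtain ⟨M, ⟨hMN, hM, hM0⟩, hmin⟩ := (wellFounded_lt (α := Submodule ℂ (Tens d n))).has_min
    {M | M ≤ N ∧ IsSUInvariant M ∧ M ≠ ⊥} ⟨N, le_rfl, hN, hne⟩
  refine ⟨M, hMN, hM, hM0, fun N' hN' hle => ?_⟩
  by_contra! h
  exact hmin N' ⟨hle.trans hMN, hN', h.1⟩ (lt_of_le_of_ne hle h.2)

/-- Complete reducibility: the orthogonal complement of the sum is invariant, so if it were non-zero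
it would contain an irreducible subspace, which also lies in the sum. -/
theorem sSup_isSUIrreducible (d n : ℕ) :
    sSup {N : Submodule ℂ (Tens d n) | IsSUIrreducible N} = ⊤ := by
  set T := sSup {N : Submodule ℂ (Tens d n) | IsSUIrreducible N}
  have hT : IsSUInvariant T := isSUInvariant_sSup fun N hN => hN.1
  rw [← Submodule.orthogonal_eq_bot_iff]
  by_contra h
  obtain ⟨N, hN, hirr⟩ := exists_isSUIrreducible_le hT.orthogonal h
  refine hirr.2.1 (le_bot_iff.mp ?_)
  rw [← T.inf_orthogonal_eq_bot]
  exact le_inf (le_sSup hirr) hN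

theorem iSup_youngBlock (n : ℕ) : ⨆ m : youngIndices 2 n, youngBlock 2 n m = ⊤ := by
  rw [eq_top_iff, ← sSup_isSUIrreducible]
  refine sSup_le fun N hN => ?_
  obtain ⟨m, hm, v, hv, hwt⟩ := exists_isHighestWeightVector hN.1 hN.2.1
  exact (le_sSup ⟨hN, v, hv, hwt⟩ : N ≤ youngBlock 2 n m).trans
    (le_iSup (fun m : youngIndices 2 n => youngBlock 2 n m) ⟨m, hm⟩)

/-- Inside an irreducible `N`, the Casimir eigenvectors of this value form an invariant subspace
containing the highest weight vector, hence all of `N`. -/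
theorem casimir_of_mem_youngBlock {n : ℕ} {m : Fin 2 → ℕ} {v : Tens 2 n}
    (hv : v ∈ youngBlock 2 n m) : casimir 2 n v = (casimirValue m : ℂ) • v := by
  suffices h : youngBlock 2 n m ≤
      Module.End.eigenspace (casimir 2 n).toLinearMap (casimirValue m : ℂ) from
    Module.End.mem_eigenspace_iff.mp (h hv)
  refine sSup_le ?_
  rintro N ⟨hN, w, hw, hwt⟩
  set K := Module.End.eigenspace (casimir 2 n).toLinearMap (casimirValue m : ℂ)
  have hK : IsSUInvariant (N ⊓ K) := by
    rintro U hU u ⟨hu, huK⟩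
    refine ⟨hN.1 U hU u hu, Module.End.mem_eigenspace_iff.mpr ?_⟩
    have : casimir 2 n u = (casimirValue m : ℂ) • u := Module.End.mem_eigenspace_iff.mp huK
    change casimir 2 n (tensorPow n U u) = _
    rw [casimir_comm_tensorPow, this, map_smul]
  rcases hN.2.2 _ hK inf_le_left with h | h
  · refine absurd ?_ hwt.1
    have : w ∈ N ⊓ K := ⟨hw, Module.End.mem_eigenspace_iff.mpr hwt.casimir_eq⟩
    rwa [h, Submodule.mem_bot] at this
  · exact inf_eq_left.mp h

theorem mem_youngIndices_two {n : ℕ} {m : Fin 2 → ℕ} :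
    m ∈ youngIndices 2 n ↔ m 0 + m 1 = n ∧ m 1 ≤ m 0 := by
  simp only [youngIndices, Finset.mem_filter, Finset.mem_piAntidiag, Finset.mem_univ,
    Fin.sum_univ_two]
  refine ⟨fun h => ⟨h.1.1, h.2 (by decide)⟩, fun h => ⟨⟨h.1, by simp⟩, fun a b hab => ?_⟩⟩
  fin_cases a <;> fin_cases b <;> simp_all

theorem casimirValue_injOn (n : ℕ) :
    Set.InjOn casimirValue (youngIndices 2 n : Set (Fin 2 → ℕ)) := by
  intro m hm m' hm' h
  rw [Finset.mem_coe, mem_youngIndices_two] at hm hm'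
  have e : (m 0 : ℝ) + m 1 = m' 0 + m' 1 := by exact_mod_cast hm.1.trans hm'.1.symm
  have l : (m 1 : ℝ) ≤ m 0 := by exact_mod_cast hm.2
  have l' : (m' 1 : ℝ) ≤ m' 0 := by exact_mod_cast hm'.2
  -- The difference of the two values factors. The second factor is positive because `m 0 ≥ n/2 ≥ m'
  -- 1`.
  have h1 : ((m 1 : ℝ) - m' 1) * (m 0 - m' 1 + 1) = 0 := by
    simp only [casimirValue] at h
    have e0 : (m' 0 : ℝ) = m 0 + m 1 - m' 1 := by linarith
    rw [e0] at h
    linear_combination (-1 / 2 : ℝ) * h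
  have h2 : (m 1 : ℝ) = m' 1 := by
    rcases mul_eq_zero.mp h1 with h | h <;> linarith
  have h3 : (m 0 : ℝ) = m' 0 := by linarith
  ext a
  fin_cases a
  · exact_mod_cast h3
  · exact_mod_cast h2

theorem inner_eq_zero_of_casimir {n : ℕ} {c c' : ℝ} (hc : c ≠ c') {v w : Tens 2 n}
    (hv : casimir 2 n v = (c : ℂ) • v) (hw : casimir 2 n w = (c' : ℂ) • w) :
    inner ℂ v w = 0 := by
  have h := inner_casimir_left v w
  rw [hv, hw, inner_smul_left, inner_smul_right, Complex.conj_ofReal] at h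
  have h2 : ((c : ℂ) - c') * inner ℂ v w = 0 := by linear_combination h
  refine (mul_eq_zero.mp h2).resolve_left fun h => hc ?_
  exact_mod_cast sub_eq_zero.mp h

theorem orthogonalFamily_youngBlock (n : ℕ) :
    OrthogonalFamily ℂ (fun m : youngIndices 2 n => youngBlock 2 n m)
      fun m => (youngBlock 2 n m).subtypeₗᵢ := by
  intro m m' hmm' v w
  exact inner_eq_zero_of_casimir
    (fun h => hmm' (Subtype.ext (casimirValue_injOn n m.2 m'.2 h)))
    (casimir_of_mem_youngBlock v.2) (casimir_of_mem_youngBlock w.2)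

theorem sum_youngProj_apply {n : ℕ} (v : Tens 2 n) :
    ∑ m ∈ youngIndices 2 n, youngProj 2 n m v = v := by
  rw [← Finset.sum_coe_sort]
  exact (orthogonalFamily_youngBlock n).sum_projection_of_mem_iSup v
    (by rw [iSup_youngBlock]; trivial)

theorem youngProj_mem {n : ℕ} (m : Fin 2 → ℕ) (v : Tens 2 n) :
    youngProj 2 n m v ∈ youngBlock 2 n m := Submodule.starProjection_apply_mem _ _

theorem casimir_youngProj {n : ℕ} (m : Fin 2 → ℕ) (v : Tens 2 n) :
    casimir 2 n (youngProj 2 n m v) = (casimirValue m : ℂ) • youngProj 2 n m v :=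
  casimir_of_mem_youngBlock (youngProj_mem m v)

theorem youngProj_eq_zero_of_casimir {n : ℕ} {m m' : Fin 2 → ℕ} (hm : m ∈ youngIndices 2 n)
    (hm' : m' ∈ youngIndices 2 n) (hmm' : m ≠ m') {v : Tens 2 n}
    (hv : casimir 2 n v = (casimirValue m' : ℂ) • v) : youngProj 2 n m v = 0 := by
  refine Submodule.eq_starProjection_of_mem_of_inner_eq_zero (Submodule.zero_mem _) fun w hw => ?_
  rw [sub_zero, inner_eq_zero_symm]
  exact inner_eq_zero_of_casimir (fun h => hmm' (casimirValue_injOn n hm hm' h))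
    (casimir_of_mem_youngBlock hw) hv

theorem youngProj_eq_self_of_casimir {n : ℕ} {m : Fin 2 → ℕ} (hm : m ∈ youngIndices 2 n)
    {v : Tens 2 n} (hv : casimir 2 n v = (casimirValue m : ℂ) • v) : youngProj 2 n m v = v := by
  conv_rhs => rw [← sum_youngProj_apply v]
  rw [Finset.sum_eq_single_of_mem m hm fun m' hm' h =>
    youngProj_eq_zero_of_casimir hm' hm h hv]

/-- Everything that commutes with the Casimir operator commutes with the Young projections. -/
theorem youngProj_comm {n : ℕ} {m : Fin 2 → ℕ} (hm : m ∈ youngIndices 2 n)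
    (T : Tens 2 n →L[ℂ] Tens 2 n) (hT : ∀ v, casimir 2 n (T v) = T (casimir 2 n v)) (v : Tens 2 n) :
    youngProj 2 n m (T v) = T (youngProj 2 n m v) := by
  -- `T` keeps each component `P_{m'} v` in its Casimir eigenspace, so `P_m T` sees only the
  -- component with `m' = m`.
  have hc : ∀ m', casimir 2 n (T (youngProj 2 n m' v))
      = (casimirValue m' : ℂ) • T (youngProj 2 n m' v) := fun m' => by
    rw [hT, casimir_youngProj, map_smul]
  conv_lhs => rw [← sum_youngProj_apply v, map_sum, map_sum]
  rw [Finset.sum_eq_single_of_mem m hm fun m' hm' h =>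
    youngProj_eq_zero_of_casimir hm hm' h.symm (hc m')]
  exact youngProj_eq_self_of_casimir hm (hc m)

theorem inner_youngProj_youngProj {n : ℕ} {m m' : Fin 2 → ℕ} (hm : m ∈ youngIndices 2 n)
    (hm' : m' ∈ youngIndices 2 n) (hmm' : m ≠ m') (v w : Tens 2 n) :
    inner ℂ (youngProj 2 n m v) (youngProj 2 n m' w) = 0 :=
  inner_eq_zero_of_casimir (fun h => hmm' (casimirValue_injOn n hm hm' h))
    (casimir_youngProj m v) (casimir_youngProj m' w)

theorem sum_norm_sq_youngProj {n : ℕ} (v : Tens 2 n) :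
    ∑ m ∈ youngIndices 2 n, ‖youngProj 2 n m v‖ ^ 2 = ‖v‖ ^ 2 := by
  refine Complex.ofReal_injective ?_
  push_cast
  have h : (inner ℂ v v : ℂ) = ∑ m ∈ youngIndices 2 n,
      inner ℂ (youngProj 2 n m v) (youngProj 2 n m v) := by
    conv_lhs => rw [← sum_youngProj_apply v, sum_inner]
    refine Finset.sum_congr rfl fun m hm => ?_
    rw [inner_sum]
    exact Finset.sum_eq_single_of_mem m hm fun m' hm' h =>
      inner_youngProj_youngProj hm hm' h.symm v v
  simp only [inner_self_eq_norm_sq_to_K] at h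
  exact h.symm

/-! ### Moments of the Casimir operator at a word -/

/-- The operator `∑ᵢ 1 ⊗ ⋯ ⊗ E₀₁ ⊗ ⋯ ⊗ 1`. -/
abbrev raising (n : ℕ) : Tens 2 n →L[ℂ] Tens 2 n := lieAct n (Matrix.single 0 1 1)

/-- The operator `∑ᵢ 1 ⊗ ⋯ ⊗ E₁₀ ⊗ ⋯ ⊗ 1`. -/
abbrev lowering (n : ℕ) : Tens 2 n →L[ℂ] Tens 2 n := lieAct n (Matrix.single 1 0 1)

/-- The vector `R^j δ_x`. -/
def raisedWord {n : ℕ} (x : Fin n → Fin 2) (j : ℕ) : Tens 2 n :=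
  (raising n)^[j] (EuclideanSpace.single x 1)

theorem raisedWord_succ {n : ℕ} (x : Fin n → Fin 2) (j : ℕ) :
    raisedWord x (j + 1) = raising n (raisedWord x j) := Function.iterate_succ_apply' _ _ _

/-- Each application of `R` turns one letter 1 into 0, so a word with `j` flipped letters is reached
once for every order of the flips. -/
theorem raisedWord_apply {n : ℕ} (x : Fin n → Fin 2) (j : ℕ) (y : Fin n → Fin 2) :
    raisedWord x j y = if (∀ i, y i ≠ x i → x i = 1) ∧
      (Finset.univ.filter fun i => y i ≠ x i).card = j then (j.factorial : ℂ) else 0 := by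
  induction j generalizing y with
  | zero =>
    simp only [raisedWord, Function.iterate_zero, id, PiLp.single_apply, Finset.card_eq_zero,
      Finset.filter_eq_empty_iff, Nat.factorial_zero, Nat.cast_one]
    refine if_congr ⟨?_, ?_⟩ rfl rfl
    · rintro rfl; simp
    · rintro ⟨-, h⟩
      ext1 i
      simpa using h (Finset.mem_univ i)
  | succ j ih =>
    rw [raisedWord_succ, lieAct_single_apply]
    have h01 : ∀ c : Fin 2, c = 0 ∨ c = 1 := by decide
    have hstep : ∀ i, y i = 0 → x i = 1 →
        (Finset.univ.filter fun l => y l ≠ x l)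
          = insert i (Finset.univ.filter fun l => Function.update y i 1 l ≠ x l) := by
      intro i hy hx
      ext l
      by_cases hl : l = i
      · subst hl; simp [hy, hx]
      · simp [hl]
    have hcard : ∀ i, y i = 0 → x i = 1 →
        (Finset.univ.filter fun l => y l ≠ x l).card
          = (Finset.univ.filter fun l => Function.update y i 1 l ≠ x l).card + 1 := by
      intro i hy hx
      rw [hstep i hy hx, Finset.card_insert_of_notMem (by simp [hx])]
    by_cases hc : (∀ i, y i ≠ x i → x i = 1) ∧
      (Finset.univ.filter fun i => y i ≠ x i).card = j + 1
    · rw [if_pos hc]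
      have : ∀ i, (if y i = 0 then raisedWord x j (Function.update y i 1) else 0)
          = if y i ≠ x i then (j.factorial : ℂ) else 0 := by
        intro i
        by_cases hne : y i = x i
        · rw [if_neg (not_not.mpr hne)]
          split_ifs with hy
          · rw [ih, if_neg]
            rintro ⟨h, -⟩
            have := h i (by simp [← hne, hy])
            rw [← hne, hy] at this
            exact absurd this (by decide)
          · rfl
        · have hx := hc.1 i hne
          have hy : y i = 0 := (h01 _).resolve_right fun h => hne (h.trans hx.symm)
          rw [if_pos hy, if_pos hne, ih, if_pos]
          refine ⟨fun l hl => ?_, ?_⟩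
          · by_cases hli : l = i
            · rwa [hli]
            · rw [Function.update_of_ne hli] at hl
              exact hc.1 l hl
          · have := hcard i hy hx
            omega
      simp only [this]
      rw [← Finset.sum_filter, Finset.sum_const, hc.2, Nat.factorial_succ]
      simp
    · rw [if_neg hc]
      refine Finset.sum_eq_zero fun i _ => ?_
      split_ifs with hy
      · rw [ih, if_neg]
        rintro ⟨h, hj⟩
        have hx : x i = 1 := by
          refine (h01 (x i)).resolve_left fun hx => ?_
          have := h i (by simp [hx])
          rw [hx] at this
          exact absurd this (by decide)
        refine hc ⟨fun l hl => ?_, ?_⟩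
        · by_cases hli : l = i
          · rwa [hli]
          · exact h l (by rwa [Function.update_of_ne hli])
        · rw [hcard i hy hx, hj]
      · rfl

theorem letterCount_of_raisedWord_ne_zero {n : ℕ} {x : Fin n → Fin 2} {j : ℕ} {y : Fin n → Fin 2}
    (h : raisedWord x j y ≠ 0) : letterCount 1 y + j = letterCount 1 x := by
  induction j generalizing y with
  | zero =>
    rw [raisedWord, Function.iterate_zero, id, PiLp.single_apply] at h
    rw [show y = x by by_contra h'; simp [h'] at h, add_zero]
  | succ j ih =>
    rw [raisedWord_succ, lieAct_single_apply] at h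
    obtain ⟨i, -, hi⟩ := Finset.exists_ne_zero_of_sum_ne_zero h
    have hyi : y i = 0 := by
      by_contra h; simp [h] at hi
    rw [if_pos hyi] at hi
    have h1 := letterCount_update (x := Function.update y i 1) (i := i) (a := 1) (b := 0)
      (by simp) (by decide)
    rw [Function.update_idem, ← hyi, Function.update_eq_self] at h1
    have := ih hi
    omega

/-- Pair with the all-ones vector and move `R` to the other side: its adjoint sends that vector to
`y ↦ letterCount 1 y`. -/
theorem sum_raising_apply {n : ℕ} (f : Tens 2 n) :
    ∑ y, raising n f y = ∑ y, letterCount 1 y * f y := by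
  have h := inner_lieAct_single_left (n := n) 1 0 (WithLp.toLp 2 fun _ => 1) f
  simp only [inner_tens, lieAct_single_apply, map_one, one_mul] at h
  rw [raising]
  simp only [lieAct_single_apply]
  rw [← h]
  refine Finset.sum_congr rfl fun y _ => ?_
  congr 1
  simp [letterCount]

theorem sum_raisedWord {n : ℕ} (x : Fin n → Fin 2) (j : ℕ) :
    ∑ y, raisedWord x j y = ((letterCount 1 x).descFactorial j : ℂ) := by
  induction j with
  | zero => simp [raisedWord]
  | succ j ih =>
    rw [raisedWord_succ, sum_raising_apply, Nat.descFactorial_succ, Nat.cast_mul, ← ih,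
      Finset.mul_sum]
    refine Finset.sum_congr rfl fun y _ => ?_
    by_cases h : raisedWord x j y = 0
    · simp [h]
    · rw [← letterCount_of_raisedWord_ne_zero h, Nat.add_sub_cancel]

/-- The entries are 0 or `j!`, so the sum of their squares is `j!` times their sum. -/
theorem norm_sq_raisedWord {n : ℕ} (x : Fin n → Fin 2) (j : ℕ) :
    ‖raisedWord x j‖ ^ 2 = j.factorial * ((letterCount 1 x).descFactorial j : ℝ) := by
  refine Complex.ofReal_injective ?_
  have h : inner ℂ (raisedWord x j) (raisedWord x j)
      = (j.factorial : ℂ) * ((letterCount 1 x).descFactorial j : ℂ) := by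
    rw [inner_tens, ← sum_raisedWord, Finset.mul_sum]
    refine Finset.sum_congr rfl fun y _ => ?_
    rw [raisedWord_apply]
    split_ifs <;> simp
  rw [inner_self_eq_norm_sq_to_K] at h
  push_cast
  exact h

/-- The eigenvalue of `L R` on the vectors of weight `(n - k, k)` in a Casimir eigenspace. -/
def lowerRaiseValue (n : ℕ) (c k : ℝ) : ℝ := (c - (n - k) ^ 2 - k ^ 2 + 2 * k) / 2

/-- `P_m` commutes with `R`, and `g = P_m R^j δ_x` is a weight vector in a Casimir eigenspace, so `L
R g` is a multiple of `g` by `casimir_eq`; then `‖R g‖² = ⟪g, L R g⟫`. -/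
theorem norm_sq_youngProj_raisedWord_succ {n : ℕ} {m : Fin 2 → ℕ} (hm : m ∈ youngIndices 2 n)
    (x : Fin n → Fin 2) (j : ℕ) :
    ‖youngProj 2 n m (raisedWord x (j + 1))‖ ^ 2
      = lowerRaiseValue n (casimirValue m) (letterCount 1 x - j)
        * ‖youngProj 2 n m (raisedWord x j)‖ ^ 2 := by
  set g := youngProj 2 n m (raisedWord x j) with hg
  have hR : youngProj 2 n m (raisedWord x (j + 1)) = raising n g := by
    rw [raisedWord_succ, youngProj_comm hm _ fun v => casimir_comm_lieAct _ v]
  have hH : lieAct n (Matrix.single 1 1 1) g = (((letterCount 1 x : ℝ) - j : ℝ) : ℂ) • g := by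
    rw [hg, ← youngProj_comm hm _ fun v => casimir_comm_lieAct _ v, ← map_smul]
    congr 1
    ext y
    rw [lieAct_diag_apply, PiLp.smul_apply, smul_eq_mul]
    by_cases h : raisedWord x j y = 0
    · simp [h]
    · rw [← letterCount_of_raisedWord_ne_zero h]; simp
  have hLR : lowering n (raising n g)
      = (lowerRaiseValue n (casimirValue m) (letterCount 1 x - j) : ℂ) • g := by
    ext y
    have h1 := congrArg (fun f : Tens 2 n => f y) hH
    have h2 := congrArg (fun f : Tens 2 n => f y) (casimir_youngProj m (raisedWord x j))
    have h3 : (letterCount 0 y : ℂ) + letterCount 1 y = n := by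
      exact_mod_cast letterCount_zero_add_one y
    simp only [PiLp.smul_apply, smul_eq_mul, lieAct_diag_apply, ← hg] at h1 h2
    rw [casimir_eq (a := 0) (b := 1) (by decide)] at h2
    simp only [PiLp.smul_apply, smul_eq_mul, lowerRaiseValue]
    push_cast at h1 ⊢
    have h4 : (letterCount 0 y : ℂ) = n - letterCount 1 y := by linear_combination h3
    rw [h4] at h2
    linear_combination h2 / 2
      - ((letterCount 1 y : ℂ) + ((letterCount 1 x : ℂ) - j) - n - 1) * h1
  rw [hR]
  refine Complex.ofReal_injective ?_
  have h := inner_lieAct_single_left (n := n) 0 1 g (raising n g)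
  rw [hLR, inner_smul_right, inner_self_eq_norm_sq_to_K, inner_self_eq_norm_sq_to_K] at h
  rw [Complex.ofReal_mul, Complex.ofReal_pow, Complex.ofReal_pow]
  exact h

/-- If a centred distribution has variance `D`, third moment `D (n - 2)` and values at least
`-n`, then it is not concentrated on a single point. -/
theorem le_sum_mul_one_sub {ι : Type} [DecidableEq ι] {s : Finset ι} {q z : ι → ℝ} {D n : ℝ}
    (hn : 0 < n) (hq : ∀ i ∈ s, 0 ≤ q i) (h0 : ∑ i ∈ s, q i = 1) (h1 : ∑ i ∈ s, q i * z i = 0)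
    (h2 : ∑ i ∈ s, q i * z i ^ 2 = D) (h3 : ∑ i ∈ s, q i * z i ^ 3 = D * (n - 2))
    (hz : ∀ i ∈ s, q i ≠ 0 → -n ≤ z i) :
    D / (576 * n ^ 2) ≤ ∑ i ∈ s, q i * (1 - q i) := by
  have hD : 0 ≤ D := h2 ▸ Finset.sum_nonneg fun i hi => mul_nonneg (hq i hi) (sq_nonneg _)
  have hq1 : ∀ i ∈ s, q i ≤ 1 := fun i hi => h0 ▸ Finset.single_le_sum hq hi
  have hdiag : 2 * ∑ i ∈ s, q i ^ 2 * z i ^ 2 ≤ D := by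
    -- Off the diagonal `(z i - z j)² ≤ 2 z i² + 2 z j²`, while the diagonal terms on the left
    -- vanish and the correction removes them on the right. The two sides evaluate to `2 D` and `4 D
    -- - 4 ∑ q i² z i²`.
    have key : ∑ i ∈ s, ∑ j ∈ s, q i * q j * (z i - z j) ^ 2
        ≤ ∑ i ∈ s, ∑ j ∈ s, (q i * q j * (2 * z i ^ 2 + 2 * z j ^ 2)
          - if i = j then 4 * (q i ^ 2 * z i ^ 2) else 0) := by
      refine Finset.sum_le_sum fun i hi => Finset.sum_le_sum fun j hj => ?_
      split_ifs with h
      · subst h; apply le_of_eq; ring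
      · have := mul_nonneg (hq i hi) (hq j hj)
        nlinarith [sq_nonneg (z i + z j)]
    have e1 : ∑ i ∈ s, ∑ j ∈ s, q i * q j * (z i - z j) ^ 2 = 2 * D := by
      have : ∀ i j, q i * q j * (z i - z j) ^ 2 = q i * z i ^ 2 * q j
          - 2 * (q i * z i) * (q j * z j) + q i * (q j * z j ^ 2) := fun i j => by ring
      simp only [this, Finset.sum_add_distrib, Finset.sum_sub_distrib, ← Finset.mul_sum,
        ← Finset.sum_mul, h0, h1, h2]
      ring
    have e2 : ∑ i ∈ s, ∑ j ∈ s, (q i * q j * (2 * z i ^ 2 + 2 * z j ^ 2)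
          - if i = j then 4 * (q i ^ 2 * z i ^ 2) else 0)
        = 4 * D - 4 * ∑ i ∈ s, q i ^ 2 * z i ^ 2 := by
      have : ∀ i j, q i * q j * (2 * z i ^ 2 + 2 * z j ^ 2)
          = 2 * (q i * z i ^ 2) * q j + 2 * q i * (q j * z j ^ 2) := fun i j => by ring
      simp only [this, Finset.sum_add_distrib, Finset.sum_sub_distrib, ← Finset.mul_sum,
        ← Finset.sum_mul, h0, h2, Finset.sum_ite_eq]
      rw [Finset.sum_congr rfl fun i hi => if_pos hi, ← Finset.mul_sum]
      ring
    linarith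
  have hterm : ∀ i ∈ s, q i * z i ^ 2 - q i ^ 2 * z i ^ 2
      ≤ 144 * n ^ 2 * (q i * (1 - q i)) + (q i * z i ^ 3 + 2 * n * (q i * z i ^ 2)) / (12 * n) := by
    intro i hi
    by_cases hqi : q i = 0
    · simp [hqi]
    have hzi := hz i hi hqi
    -- For negative `z i` this is `2 z i² (z i + n) ≥ 0`; it replaces the absolute third moment by
    -- known moments.
    have hz3 : |z i| ^ 3 ≤ z i ^ 3 + 2 * n * z i ^ 2 := by
      rcases abs_cases (z i) with ⟨h, h'⟩ | ⟨h, h'⟩ <;> rw [h]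
      · have : 0 ≤ 2 * n * z i ^ 2 := by positivity
        linarith
      · nlinarith [mul_nonneg (sq_nonneg (z i)) (by linarith : 0 ≤ z i + n)]
    -- The cutoff `12 n` makes the tail contribute at most `3 n D / (12 n) = D / 4`, half of the `D
    -- / 2` left by `hdiag`.
    have hz2 : z i ^ 2 ≤ 144 * n ^ 2 + |z i| ^ 3 / (12 * n) := by
      rcases le_total (|z i|) (12 * n) with h | h
      · have : 0 ≤ |z i| ^ 3 / (12 * n) := by positivity
        have : z i ^ 2 ≤ (12 * n) ^ 2 := sq_le_sq' (by linarith [(abs_le.mp h).1]) (abs_le.mp h).2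
        linarith
      · have : z i ^ 2 ≤ |z i| ^ 3 / (12 * n) := by
          rw [le_div_iff₀ (by positivity), ← sq_abs]
          nlinarith [sq_nonneg (|z i|)]
        have : 0 ≤ 144 * n ^ 2 := by positivity
        linarith
    have hA : |z i| ^ 3 / (12 * n) ≤ (z i ^ 3 + 2 * n * z i ^ 2) / (12 * n) := by gcongr
    have hB : 0 ≤ (z i ^ 3 + 2 * n * z i ^ 2) / (12 * n) := le_trans (by positivity) hA
    have hqn := hq i hi
    have hq1' := hq1 i hi
    calc q i * z i ^ 2 - q i ^ 2 * z i ^ 2 = q i * (1 - q i) * z i ^ 2 := by ring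
      _ ≤ q i * (1 - q i) * (144 * n ^ 2 + (z i ^ 3 + 2 * n * z i ^ 2) / (12 * n)) :=
        mul_le_mul_of_nonneg_left (hz2.trans (by linarith))
          (mul_nonneg hqn (by linarith))
      _ = 144 * n ^ 2 * (q i * (1 - q i))
          + q i * (1 - q i) * ((z i ^ 3 + 2 * n * z i ^ 2) / (12 * n)) := by ring
      _ ≤ 144 * n ^ 2 * (q i * (1 - q i)) + q i * ((z i ^ 3 + 2 * n * z i ^ 2) / (12 * n)) := by
        gcongr
        nlinarith
      _ = _ := by ring
  have hsum := Finset.sum_le_sum hterm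
  rw [Finset.sum_sub_distrib, Finset.sum_add_distrib, ← Finset.mul_sum, ← Finset.sum_div,
    Finset.sum_add_distrib, ← Finset.mul_sum, h2, h3] at hsum
  have : (D * (n - 2) + 2 * n * D) / (12 * n) ≤ D / 4 := by
    rw [div_le_iff₀ (by positivity)]; nlinarith
  rw [div_le_iff₀ (by positivity)]
  linarith

/-- A word with both letters is not close to a single Young block. -/
theorem letterCount_mul_le {n : ℕ} (hn : 0 < n) (x : Fin n → Fin 2) :
    (letterCount 0 x : ℝ) * letterCount 1 x / (576 * (n : ℝ) ^ 2) ≤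
      ∑ m ∈ youngIndices 2 n, ‖youngProj 2 n m (EuclideanSpace.single x 1)‖ ^ 2 *
        (1 - ‖youngProj 2 n m (EuclideanSpace.single x 1)‖ ^ 2) := by
  classical
  set k : ℝ := (letterCount 1 x : ℝ) with hk
  have hk0 : 0 ≤ k := Nat.cast_nonneg _
  have hc0 : (letterCount 0 x : ℝ) = n - k := by
    have : (letterCount 0 x : ℝ) + letterCount 1 x = n := by
      exact_mod_cast letterCount_zero_add_one x
    linarith
  have hkn : k ≤ n := by
    have : (0 : ℝ) ≤ letterCount 0 x := Nat.cast_nonneg _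
    linarith
  set q : (Fin 2 → ℕ) → ℝ := fun m => ‖youngProj 2 n m (EuclideanSpace.single x 1)‖ ^ 2 with hq
  set a : (Fin 2 → ℕ) → ℝ := fun m => lowerRaiseValue n (casimirValue m) k with ha
  have e0 : ∀ m, ‖youngProj 2 n m (raisedWord x 0)‖ ^ 2 = q m := fun m => rfl
  have e1 : ∀ m ∈ youngIndices 2 n, ‖youngProj 2 n m (raisedWord x 1)‖ ^ 2 = a m * q m :=
    fun m hm => by
      rw [norm_sq_youngProj_raisedWord_succ hm, e0, Nat.cast_zero, sub_zero]
  -- Lowering `k` by one lowers the eigenvalue of `L R` by `n - 2k + 2`; the next step lowers it by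
  -- `n - 2k + 4`.
  have e2 : ∀ m ∈ youngIndices 2 n, ‖youngProj 2 n m (raisedWord x 2)‖ ^ 2
      = (a m - (n - 2 * k + 2)) * (a m * q m) := fun m hm => by
    rw [norm_sq_youngProj_raisedWord_succ hm, e1 m hm, ha]
    simp only [lowerRaiseValue, ← hk]
    push_cast; ring
  have e3 : ∀ m ∈ youngIndices 2 n, ‖youngProj 2 n m (raisedWord x 3)‖ ^ 2
      = (a m - 2 * (n - 2 * k + 2) - 2) * ((a m - (n - 2 * k + 2)) * (a m * q m)) := fun m hm => by
    rw [norm_sq_youngProj_raisedWord_succ hm, e2 m hm, ha]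
    simp only [lowerRaiseValue, ← hk]
    push_cast; ring
  have hdesc : ∀ j, ∑ m ∈ youngIndices 2 n, ‖youngProj 2 n m (raisedWord x j)‖ ^ 2
      = j.factorial * ((letterCount 1 x).descFactorial j : ℝ) := fun j => by
    rw [sum_norm_sq_youngProj, norm_sq_raisedWord]
  have s0 := hdesc 0
  have s1 := hdesc 1
  have s2 := hdesc 2
  have s3 := hdesc 3
  rw [Finset.sum_congr rfl e1] at s1
  rw [Finset.sum_congr rfl e2] at s2
  rw [Finset.sum_congr rfl e3] at s3
  -- As polynomial identities over `ℝ`, this and `f3` also hold for small `k`, where both sides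
  -- vanish.
  have f2 : ((letterCount 1 x).descFactorial 2 : ℝ) = k * (k - 1) := by
    rw [← descPochhammer_eval_eq_descFactorial]
    simp [descPochhammer_succ_right, ← hk]
  have f3 : ((letterCount 1 x).descFactorial 3 : ℝ) = k * (k - 1) * (k - 2) := by
    rw [← descPochhammer_eval_eq_descFactorial]
    simp [descPochhammer_succ_right, ← hk]
  rw [f2] at s2
  rw [f3] at s3
  simp only [e0, Nat.factorial, Nat.descFactorial_zero, Nat.descFactorial_one, ← hk] at s0 s1 s2 s3
  norm_num at s0 s1 s2 s3
  rw [hc0]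
  have t2 : ∑ m ∈ youngIndices 2 n, q m * a m ^ 2 = n * k := by
    have : ∀ m, q m * a m ^ 2 = (a m - (n - 2 * k + 2)) * (a m * q m)
      + (n - 2 * k + 2) * (a m * q m) := fun m => by ring
    simp only [this, Finset.sum_add_distrib, ← Finset.mul_sum]
    rw [s1, s2]; ring
  have t3 : ∑ m ∈ youngIndices 2 n, q m * a m ^ 3
      = 6 * (k * (k - 1) * (k - 2)) + (3 * (n - 2 * k + 2) + 2) * (n * k)
        - (n - 2 * k + 2) * (2 * (n - 2 * k + 2) + 2) * k := by
    have : ∀ m, q m * a m ^ 3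
      = (a m - 2 * (n - 2 * k + 2) - 2) * ((a m - (n - 2 * k + 2)) * (a m * q m))
      + (3 * (n - 2 * k + 2) + 2) * (q m * a m ^ 2)
      - (n - 2 * k + 2) * (2 * (n - 2 * k + 2) + 2) * (a m * q m) := fun m => by ring
    simp only [this, Finset.sum_add_distrib, Finset.sum_sub_distrib, ← Finset.mul_sum]
    rw [s1, s3, t2]
  refine le_sum_mul_one_sub (q := q) (z := fun m => a m - k) (by exact_mod_cast hn)
    (fun m _ => sq_nonneg _) s0 ?_ ?_ ?_ ?_
  · have : ∀ m, q m * (a m - k) = a m * q m - k * q m := fun m => by ring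
    change ∑ m ∈ youngIndices 2 n, q m * (a m - k) = 0
    simp only [this, Finset.sum_sub_distrib, ← Finset.mul_sum]
    rw [s1, s0]; ring
  · have : ∀ m, q m * (a m - k) ^ 2 = q m * a m ^ 2 - 2 * k * (a m * q m) + k ^ 2 * q m :=
      fun m => by ring
    change ∑ m ∈ youngIndices 2 n, q m * (a m - k) ^ 2 = _
    simp only [this, Finset.sum_add_distrib, Finset.sum_sub_distrib, ← Finset.mul_sum]
    rw [t2, s1, s0]; ring
  · have : ∀ m, q m * (a m - k) ^ 3 = q m * a m ^ 3 - 3 * k * (q m * a m ^ 2)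
      + 3 * k ^ 2 * (a m * q m) - k ^ 3 * q m := fun m => by ring
    change ∑ m ∈ youngIndices 2 n, q m * (a m - k) ^ 3 = _
    simp only [this, Finset.sum_add_distrib, Finset.sum_sub_distrib, ← Finset.mul_sum]
    rw [t3, t2, s1, s0]; ring
  -- `a m * q m` is a squared norm, so `a m ≥ 0` wherever `q m ≠ 0`, and `a m - k ≥ -k ≥ -n`.
  · intro m hm hqm
    have h1 : 0 ≤ a m * q m := e1 m hm ▸ sq_nonneg _
    have h2 : 0 < q m := lt_of_le_of_ne (sq_nonneg _) (Ne.symm hqm)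
    have := nonneg_of_mul_nonneg_left h1 h2
    linarith

/-! ### The Bures distance of pure states -/

section Pure

variable {E : Type} [NormedAddCommGroup E] [InnerProductSpace ℂ E]

theorem rankOne_mul_rankOne (u v w z : E) :
    (InnerProductSpace.rankOne ℂ u v * InnerProductSpace.rankOne ℂ w z : E →L[ℂ] E)
      = (inner ℂ v w : ℂ) • InnerProductSpace.rankOne ℂ u z := by
  ext y
  simp [smul_smul, mul_comm]

theorem rankOne_self_nonneg (u : E) : (0 : E →L[ℂ] E) ≤ InnerProductSpace.rankOne ℂ u u := by
  rw [ContinuousLinearMap.nonneg_iff_isPositive]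
  exact InnerProductSpace.isPositive_rankOne_self u

variable [CompleteSpace E]

theorem sqrt_rankOne_self {u : E} (hu : ‖u‖ = 1) :
    CFC.sqrt (InnerProductSpace.rankOne ℂ u u : E →L[ℂ] E) = InnerProductSpace.rankOne ℂ u u := by
  refine CFC.sqrt_unique ?_ (rankOne_self_nonneg u)
  rw [rankOne_mul_rankOne, inner_self_eq_norm_sq_to_K, hu]
  simp

theorem sqrt_starProjection (K : Submodule ℂ E) [K.HasOrthogonalProjection] :
    CFC.sqrt K.starProjection = K.starProjection := by
  refine CFC.sqrt_unique ?_ ?_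
  · exact K.isIdempotentElem_starProjection
  · rw [ContinuousLinearMap.nonneg_iff_isPositive]
    exact ContinuousLinearMap.IsPositive.of_isStarProjection isStarProjection_starProjection

/-- The product of the two projections is `⟪v, u⟫ |v⟩⟨u|`, whose absolute value is `|⟪v, u⟫|
|u⟩⟨u|`. -/
theorem bures_sq_rankOne [FiniteDimensional ℂ E] {v u : E} (hv : ‖v‖ = 1) (hu : ‖u‖ = 1) :
    bures (InnerProductSpace.rankOne ℂ v v) (InnerProductSpace.rankOne ℂ u u) ^ 2
      = 1 - ‖(inner ℂ v u : ℂ)‖ := by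
  have habs : CFC.abs (InnerProductSpace.rankOne ℂ v v * InnerProductSpace.rankOne ℂ u u :
      E →L[ℂ] E) = (‖(inner ℂ v u : ℂ)‖ : ℂ) • InnerProductSpace.rankOne ℂ u u := by
    refine CFC.sqrt_unique ?_ ?_
    · rw [rankOne_mul_rankOne, star_smul, ContinuousLinearMap.star_eq_adjoint,
        InnerProductSpace.adjoint_rankOne, smul_mul_smul_comm, smul_mul_smul_comm,
        rankOne_mul_rankOne, rankOne_mul_rankOne, inner_self_eq_norm_sq_to_K,
        inner_self_eq_norm_sq_to_K, hv, hu, RCLike.star_def, RCLike.conj_mul]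
      simp [sq]
    · rw [Complex.coe_smul]
      exact smul_nonneg (norm_nonneg _) (rankOne_self_nonneg u)
  have htr : opTrace (InnerProductSpace.rankOne ℂ u u : E →L[ℂ] E) = 1 :=
    (InnerProductSpace.trace_rankOne u u).trans (by rw [inner_self_eq_norm_sq_to_K, hu]; simp)
  have hle : ‖(inner ℂ v u : ℂ)‖ ≤ 1 := by
    simpa [hv, hu] using norm_inner_le_norm (𝕜 := ℂ) v u
  have htr' : opTrace (CFC.abs (InnerProductSpace.rankOne ℂ v v * InnerProductSpace.rankOne ℂ u u :
      E →L[ℂ] E)) = (‖(inner ℂ v u : ℂ)‖ : ℂ) := by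
    rw [habs, opTrace, ContinuousLinearMap.toLinearMap_smul, map_smul]
    rw [opTrace] at htr
    rw [htr, smul_eq_mul, mul_one]
  rw [bures, sqrt_rankOne_self hv, sqrt_rankOne_self hu, htr', Complex.ofReal_re,
    Real.sq_sqrt (by linarith)]

end Pure

/-! ### The code with parameter zero -/

theorem mem_nearYoung_zero {n : ℕ} {k : Fin 2 → ℤ} {m : Fin 2 → ℕ} :
    m ∈ nearYoung 2 0 n k ↔ m ∈ youngIndices 2 n ∧ ∀ i, k i = m i := by
  simp only [nearYoung, Finset.mem_filter, mul_zero, euclNorm]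
  refine and_congr_right fun _ => ?_
  rw [norm_le_zero_iff]
  refine ⟨fun h i => ?_, fun h => ?_⟩
  · have := congrArg (fun f : EuclideanSpace ℝ (Fin 2) => f i) h
    have h2 : (k i : ℝ) = m i := sub_eq_zero.mp this
    exact_mod_cast h2
  · ext i
    simp [h i]

theorem nearYoung_zero {n : ℕ} {k : Fin 2 → ℤ} {m : Fin 2 → ℕ} (hm : m ∈ youngIndices 2 n)
    (hk : ∀ i, k i = m i) : nearYoung 2 0 n k = {m} := by
  ext m'
  rw [mem_nearYoung_zero, Finset.mem_singleton]
  refine ⟨fun h => ?_, fun h => h ▸ ⟨hm, hk⟩⟩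
  ext i
  exact_mod_cast (h.2 i).symm.trans (hk i)

theorem ballCount_zero (n : ℕ) : ballCount 2 (n * 0) = 1 := by
  rw [ballCount, Set.ncard_eq_one]
  refine ⟨0, ?_⟩
  ext k
  simp only [mul_zero, euclNorm, norm_le_zero_iff, Set.mem_ofPred_eq, Set.mem_singleton_iff]
  refine ⟨fun h => ?_, fun h => by subst h; simp; rfl⟩
  ext i
  have := congrArg (fun f : EuclideanSpace ℝ (Fin 2) => f i) h.1
  simpa using this

theorem effect_zero {n : ℕ} {k : Fin 2 → ℤ} {m : Fin 2 → ℕ} (hm : m ∈ youngIndices 2 n)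
    (hk : ∀ i, k i = m i) : effect 2 0 n k = youngProj 2 n m := by
  rw [effect, ballCount_zero, nearYoung_zero hm hk]
  simp

theorem codeSpace_zero {n : ℕ} {k : Fin 2 → ℤ} {m : Fin 2 → ℕ} (hm : m ∈ youngIndices 2 n)
    (hk : ∀ i, k i = m i) : codeSpace 2 0 n k = youngBlock 2 n m := by
  rw [codeSpace, nearYoung_zero hm hk]
  simp

/-- An outcome of the code, as an element of the data set. -/
def outcome {n : ℕ} (k : (youngCode 2 0 n).Ω) : dataSet 2 0 n := k

/-- At `δ = 0` a data point must coincide with a Young index, so sums over outcomes become sums over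
`youngIndices`. -/
theorem sum_outcome {M : Type} [AddCommMonoid M] {n : ℕ}
    (F : (youngCode 2 0 n).Ω → M) (G : (Fin 2 → ℕ) → M)
    (h : ∀ m ∈ youngIndices 2 n, ∀ k : (youngCode 2 0 n).Ω,
      (∀ i, (outcome k).1 i = m i) → F k = G m) :
    ∑ k, F k = ∑ m ∈ youngIndices 2 n, G m := by
  rw [← Finset.sum_coe_sort (youngIndices 2 n) G]
  let c : youngIndices 2 n → dataSet 2 0 n := fun m => ⟨fun i => (m.1 i : ℤ), by
    have := (mem_youngIndices_two.mp m.2).1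
    refine ⟨by rw [Fin.sum_univ_two]; exact_mod_cast this, m.1, ?_⟩
    rw [mem_nearYoung_zero]
    exact ⟨m.2, fun _ => rfl⟩⟩
  have hc : Function.Bijective c := by
    refine ⟨fun m m' hmm' => ?_, fun k => ?_⟩
    · ext i
      exact Nat.cast_injective (R := ℤ) (congrFun (congrArg Subtype.val hmm') i)
    · obtain ⟨m, hm⟩ := k.2.2
      rw [mem_nearYoung_zero] at hm
      exact ⟨⟨m, hm.1⟩, Subtype.ext (funext fun i => (hm.2 i).symm)⟩
  symm
  exact Fintype.sum_bijective (κ := (youngCode 2 0 n).Ω) c hc (fun m => G m) F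
    fun m => (h m.1 m.2 (c m) fun _ => rfl).symm

theorem youngProj_youngProj {n : ℕ} (m : Fin 2 → ℕ) (v : Tens 2 n) :
    youngProj 2 n m (youngProj 2 n m v) = youngProj 2 n m v :=
  Submodule.starProjection_eq_self_iff.mpr (youngProj_mem m v)

/-- For the inclusion `ι` of `W`, `ι ι†` is the idempotent projection, so encoding and decoding
together compress `A` to `W`. -/
theorem conjCP_subtypeL_smul_conjCP {E : Type} [NormedAddCommGroup E] [InnerProductSpace ℂ E]
    [FiniteDimensional ℂ E] [CompleteSpace E] (W : Submodule ℂ E) (c : ℂ) (A : E →L[ℂ] E) :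
    conjCP W.subtypeL (c • conjCP (ContinuousLinearMap.adjoint W.subtypeL ∘L W.starProjection) A)
      = c • (W.starProjection * A * W.starProjection) := by
  have hsa : ContinuousLinearMap.adjoint W.starProjection = W.starProjection :=
    (isSelfAdjoint_starProjection W).adjoint_eq
  have hidem : ∀ v, W.starProjection (W.starProjection v) = W.starProjection v := fun v =>
    Submodule.starProjection_eq_self_iff.mpr (Submodule.starProjection_apply_mem _ _)
  have hιι : ∀ v, W.subtypeL ((ContinuousLinearMap.adjoint W.subtypeL : E →L[ℂ] W) v)
      = W.starProjection v := fun v => by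
    rw [Submodule.adjoint_subtypeL]; rfl
  change W.subtypeL ∘L (c • ((ContinuousLinearMap.adjoint W.subtypeL ∘L W.starProjection) ∘L A ∘L
    ContinuousLinearMap.adjoint (ContinuousLinearMap.adjoint W.subtypeL ∘L W.starProjection)))
    ∘L ContinuousLinearMap.adjoint W.subtypeL = _
  rw [ContinuousLinearMap.adjoint_comp, ContinuousLinearMap.adjoint_adjoint, hsa]
  ext1 v
  simp only [ContinuousLinearMap.comp_apply, smul_apply, map_smul, hιι, hidem,
    mul_apply_eq_comp]

theorem youngCode_dec_smul_enc {n : ℕ} {m : Fin 2 → ℕ} (hm : m ∈ youngIndices 2 n)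
    (k : (youngCode 2 0 n).Ω) (hk : ∀ i, (outcome k).1 i = m i) (c : ℂ)
    (A : Tens 2 n →L[ℂ] Tens 2 n) :
    (youngCode 2 0 n).dec k (c • (youngCode 2 0 n).enc k A)
      = c • (youngProj 2 n m * A * youngProj 2 n m) := by
  have hP : youngProj 2 n m = (codeSpace 2 0 n (outcome k).1).starProjection := by
    rw [youngProj]; congr 1; exact (codeSpace_zero hm hk).symm
  have hsqrt : CFC.sqrt (effect 2 0 n (outcome k).1)
      = (codeSpace 2 0 n (outcome k).1).starProjection := by
    rw [effect_zero hm hk, hP, sqrt_starProjection]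
  have h := conjCP_subtypeL_smul_conjCP (codeSpace 2 0 n (outcome k).1) c A
  rw [← hP, ← hsqrt.trans hP.symm] at h
  rw [← hsqrt.trans hP.symm]
  exact h

theorem opTrace_youngCode_enc {n : ℕ} {m : Fin 2 → ℕ} (hm : m ∈ youngIndices 2 n)
    (k : (youngCode 2 0 n).Ω) (hk : ∀ i, (outcome k).1 i = m i) (A : Tens 2 n →L[ℂ] Tens 2 n) :
    opTrace ((youngCode 2 0 n).enc k A) = opTrace (youngProj 2 n m * A * youngProj 2 n m) := by
  have h := youngCode_dec_smul_enc hm k hk 1 A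
  rw [one_smul, one_smul] at h
  rw [← h]
  exact ((youngCode 2 0 n).dec_trace k _).symm

theorem youngCode_isNormalized (n : ℕ) : (youngCode 2 0 n).IsNormalized := by
  intro ρ
  refine (sum_outcome _ (fun m => opTrace (ρ.1 * youngProj 2 n m))
    fun m hm k hk => ?_).trans ?_
  · rw [opTrace_youngCode_enc hm k hk]
    have hidem : youngProj 2 n m * youngProj 2 n m = youngProj 2 n m :=
      (youngBlock 2 n m).isIdempotentElem_starProjection
    have := LinearMap.trace_mul_comm ℂ (youngProj 2 n m : Tens 2 n →ₗ[ℂ] Tens 2 n)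
      ((ρ.1 * youngProj 2 n m : Tens 2 n →L[ℂ] Tens 2 n) : Tens 2 n →ₗ[ℂ] Tens 2 n)
    rw [mul_assoc]
    refine this.trans ?_
    change opTrace (ρ.1 * youngProj 2 n m * youngProj 2 n m) = _
    rw [mul_assoc, hidem]
  · refine Eq.trans ?_ ρ.2.2
    have hsum : ∑ m ∈ youngIndices 2 n, ρ.1 * youngProj 2 n m = ρ.1 := by
      rw [← Finset.mul_sum]
      ext1 v
      rw [mul_apply_eq_comp, sum_apply, sum_youngProj_apply]
    conv_rhs => rw [← hsum]
    simp only [opTrace, ContinuousLinearMap.toLinearMap_sum, map_sum]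

theorem youngProj_mul_rankOne_mul {n : ℕ} (m : Fin 2 → ℕ) (v : Tens 2 n) :
    youngProj 2 n m * InnerProductSpace.rankOne ℂ v v * youngProj 2 n m
      = InnerProductSpace.rankOne ℂ (youngProj 2 n m v) (youngProj 2 n m v) := by
  ext1 w
  simp only [mul_apply_eq_comp, InnerProductSpace.rankOne_apply, map_smul]
  rw [youngProj, Submodule.inner_starProjection_left_eq_right]

theorem youngCode_error {n : ℕ} {v : Tens 2 n} (hv : ‖v‖ = 1) :
    (youngCode 2 0 n).error (InnerProductSpace.rankOne ℂ v v)
      = ∑ m ∈ youngIndices 2 n, ‖youngProj 2 n m v‖ ^ 2 * (1 - ‖youngProj 2 n m v‖) := by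
  refine sum_outcome _ _ fun m hm k hk => ?_
  have htr : opTrace ((youngCode 2 0 n).enc k (InnerProductSpace.rankOne ℂ v v))
      = ((‖youngProj 2 n m v‖ ^ 2 : ℝ) : ℂ) := by
    rw [opTrace_youngCode_enc hm k hk, youngProj_mul_rankOne_mul]
    refine (InnerProductSpace.trace_rankOne _ _).trans ?_
    rw [inner_self_eq_norm_sq_to_K]; simp
  rw [youngCode_dec_smul_enc hm k hk, htr, Complex.ofReal_re, youngProj_mul_rankOne_mul]
  -- An outcome of probability zero contributes 0 whatever its Bures term is.
  by_cases h0 : youngProj 2 n m v = 0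
  · simp [h0]
  congr 1
  set w := youngProj 2 n m v with hw
  have hn : ‖w‖ ≠ 0 := norm_ne_zero_iff.mpr h0
  have hu : ‖((‖w‖⁻¹ : ℝ) : ℂ) • w‖ = 1 := by
    rw [norm_smul, Complex.norm_real, norm_inv, norm_norm, inv_mul_cancel₀ hn]
  have hsm : (((‖w‖ ^ 2 : ℝ) : ℂ))⁻¹ • InnerProductSpace.rankOne ℂ w w
      = InnerProductSpace.rankOne ℂ (((‖w‖⁻¹ : ℝ) : ℂ) • w) (((‖w‖⁻¹ : ℝ) : ℂ) • w) := by
    ext1 z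
    simp only [smul_apply, InnerProductSpace.rankOne_apply, inner_smul_left, smul_smul,
      Complex.conj_ofReal]
    congr 1
    push_cast
    ring
  have hvw : (inner ℂ v w : ℂ) = ((‖w‖ ^ 2 : ℝ) : ℂ) := by
    have : inner ℂ v w = (inner ℂ w w : ℂ) := by
      conv_rhs => rw [hw, youngProj, Submodule.inner_starProjection_left_eq_right]
      rw [← youngProj, youngProj_youngProj]
    rw [this, inner_self_eq_norm_sq_to_K]; simp
  rw [hsm, bures_sq_rankOne hv hu, inner_smul_right, hvw, ← Complex.ofReal_mul, Complex.norm_real]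
  congr 1
  rw [show ‖w‖⁻¹ * ‖w‖ ^ 2 = ‖w‖ by field_simp, norm_norm]

theorem le_youngCode_error {n : ℕ} {v : Tens 2 n} (hv : ‖v‖ = 1) :
    (∑ m ∈ youngIndices 2 n, ‖youngProj 2 n m v‖ ^ 2 * (1 - ‖youngProj 2 n m v‖ ^ 2)) / 2
      ≤ (youngCode 2 0 n).error (InnerProductSpace.rankOne ℂ v v) := by
  rw [youngCode_error hv, Finset.sum_div]
  refine Finset.sum_le_sum fun m _ => ?_
  rw [mul_div_assoc]
  refine mul_le_mul_of_nonneg_left ?_ (sq_nonneg _)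
  -- `1 - t ≥ (1 - t²) / 2` is `(1 - t)² ≥ 0`.
  nlinarith [sq_nonneg (1 - ‖youngProj 2 n m v‖)]

/-! ### Product states in an arbitrary orthonormal basis -/

theorem toEuclideanCLM_symm_apply {ι : Type} [Fintype ι] [DecidableEq ι]
    (T : EuclideanSpace ℂ ι →L[ℂ] EuclideanSpace ℂ ι) (r s : ι) :
    (Matrix.toEuclideanCLM (n := ι) (𝕜 := ℂ)).symm T r s = T (EuclideanSpace.single s 1) r := by
  obtain ⟨M, rfl⟩ : ∃ M, Matrix.toEuclideanCLM (n := ι) (𝕜 := ℂ) M = T :=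
    ⟨_, StarAlgEquiv.apply_symm_apply _ T⟩
  rw [toEuclideanCLM_apply_eq_sum, StarAlgEquiv.symm_apply_apply, Finset.sum_eq_single s]
  · simp
  · intro t _ ht
    simp [ht]
  · simp

/-- The matrix whose columns are the vectors of an orthonormal basis. -/
def basisMatrix {d : ℕ} (e : OrthonormalBasis (Fin d) ℂ (Sys d)) : Matrix (Fin d) (Fin d) ℂ :=
  Matrix.of fun r c => e c r

theorem star_basisMatrix_mul_self {d : ℕ} (e : OrthonormalBasis (Fin d) ℂ (Sys d)) :
    star (basisMatrix e) * basisMatrix e = 1 := by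
  ext a b
  have h := orthonormal_iff_ite.mp e.orthonormal a b
  rw [PiLp.inner_apply] at h
  rw [Matrix.mul_apply, Matrix.one_apply, ← h]
  refine Finset.sum_congr rfl fun r _ => ?_
  simp [basisMatrix, Matrix.star_apply, mul_comm]

/-- The product vector `e_{x₁} ⊗ ⋯ ⊗ e_{xₙ}`. -/
def productVector {d n : ℕ} (e : OrthonormalBasis (Fin d) ℂ (Sys d)) (x : Fin n → Fin d) :
    Tens d n := tensorPow n (basisMatrix e) (EuclideanSpace.single x 1)

theorem productVector_apply {d n : ℕ} (e : OrthonormalBasis (Fin d) ℂ (Sys d))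
    (x y : Fin n → Fin d) : productVector e x y = ∏ i, e (x i) (y i) := by
  rw [productVector, tensorPow_apply, Finset.sum_eq_single x]
  · simp [basisMatrix]
  · intro z _ hz
    simp [hz]
  · simp

theorem norm_tensorPow_basisMatrix {d n : ℕ} (e : OrthonormalBasis (Fin d) ℂ (Sys d))
    (f : Tens d n) : ‖tensorPow n (basisMatrix e) f‖ = ‖f‖ := by
  have h := inner_tensorPow_left (basisMatrix e) f (tensorPow n (basisMatrix e) f)
  rw [← tensorPow_mul_apply, star_basisMatrix_mul_self, tensorPow_one_apply,
    inner_self_eq_norm_sq_to_K, inner_self_eq_norm_sq_to_K] at h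
  refine (sq_eq_sq₀ (norm_nonneg _) (norm_nonneg _)).mp (Complex.ofReal_injective ?_)
  rw [Complex.ofReal_pow, Complex.ofReal_pow]
  exact h

theorem norm_productVector {d n : ℕ} (e : OrthonormalBasis (Fin d) ℂ (Sys d))
    (x : Fin n → Fin d) : ‖productVector e x‖ = 1 := by
  rw [productVector, norm_tensorPow_basisMatrix]; simp

/-- The basis change is an isometric tensor power. It commutes with the Casimir operator, hence with
`P_m`, even if its determinant is not 1. -/
theorem norm_youngProj_productVector {n : ℕ} (e : OrthonormalBasis (Fin 2) ℂ (Sys 2))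
    {m : Fin 2 → ℕ} (hm : m ∈ youngIndices 2 n) (x : Fin n → Fin 2) :
    ‖youngProj 2 n m (productVector e x)‖ = ‖youngProj 2 n m (EuclideanSpace.single x 1)‖ := by
  rw [productVector, youngProj_comm hm _ fun v => casimir_comm_tensorPow _ v,
    norm_tensorPow_basisMatrix]

theorem tensorOp_rankOne {d n : ℕ} (e : OrthonormalBasis (Fin d) ℂ (Sys d)) (x : Fin n → Fin d) :
    tensorOp (fun i => InnerProductSpace.rankOne ℂ (e (x i)) (e (x i)))
      = InnerProductSpace.rankOne ℂ (productVector e x) (productVector e x) := by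
  ext f y
  rw [tensorOp_apply, InnerProductSpace.rankOne_apply, PiLp.smul_apply, smul_eq_mul, inner_tens,
    Finset.sum_mul]
  refine Finset.sum_congr rfl fun z _ => ?_
  simp only [toEuclideanCLM_symm_apply, InnerProductSpace.rankOne_apply, PiLp.smul_apply,
    smul_eq_mul, productVector_apply, map_prod, Finset.prod_mul_distrib,
    EuclideanSpace.inner_single_right, one_mul]
  ring

/-- The two pure states of the source. -/
def basisState (e : OrthonormalBasis (Fin 2) ℂ (Sys 2)) (a : Fin 2) : DensityOperator (Sys 2) :=
  pureState (e a) (e.orthonormal.norm_eq_one a)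

theorem basisState_injective (e : OrthonormalBasis (Fin 2) ℂ (Sys 2)) :
    Function.Injective (basisState e) := by
  intro a b hab
  by_contra hne
  have h := congrArg (fun ρ : DensityOperator (Sys 2) => ρ.1 (e a)) hab
  simp only [basisState, pureState, InnerProductSpace.rankOne_apply] at h
  rw [e.orthonormal.inner_eq_zero (Ne.symm hne), inner_self_eq_norm_sq_to_K,
    e.orthonormal.norm_eq_one] at h
  have h2 := e.orthonormal.norm_eq_one a
  simp at h
  simp [h] at h2

theorem letterCount_mul_le_error {n : ℕ} (hn : 0 < n) (e : OrthonormalBasis (Fin 2) ℂ (Sys 2))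
    (x : Fin n → Fin 2) :
    (letterCount 0 x : ℝ) * letterCount 1 x / (1152 * (n : ℝ) ^ 2) ≤
      (youngCode 2 0 n).error (tensorOp fun i => (basisState e (x i)).1) := by
  have h1 := letterCount_mul_le hn x
  have h2 := le_youngCode_error (norm_productVector e x)
  have h3 : (tensorOp fun i => (basisState e (x i)).1)
    = InnerProductSpace.rankOne ℂ (productVector e x) (productVector e x) := tensorOp_rankOne e x
  rw [Finset.sum_congr rfl fun m hm => by rw [norm_youngProj_productVector e hm]] at h2
  rw [h3]
  refine le_trans ?_ h2
  rw [show (1152 : ℝ) * n ^ 2 = 576 * n ^ 2 * 2 by ring, ← div_div]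
  linarith

/-! ### The average error -/

/-- Expand the product of counts over ordered pairs of places. By independence each of the `n² - n`
pairs of distinct places contributes `w 0 * w 1`; equal places contribute nothing. -/
theorem sum_prod_mul_letterCount {n : ℕ} (w : Fin 2 → ℝ) (hw : w 0 + w 1 = 1) :
    ∑ x : Fin n → Fin 2, (∏ i, w (x i)) * ((letterCount 0 x : ℝ) * letterCount 1 x)
      = (n ^ 2 - n) * (w 0 * w 1) := by
  have hcount : ∀ (c : Fin 2) (x : Fin n → Fin 2),
      (letterCount c x : ℝ) = ∑ i, if x i = c then (1 : ℝ) else 0 := fun c x => by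
    simp [letterCount]
  have hpair : ∀ i j : Fin n, ∑ x : Fin n → Fin 2,
      (∏ l, w (x l)) * ((if x i = 0 then (1 : ℝ) else 0) * if x j = 1 then (1 : ℝ) else 0)
      = w 0 * w 1 - if i = j then w 0 * w 1 else 0 := by
    intro i j
    by_cases hij : i = j
    · subst hij
      rw [if_pos rfl, sub_self]
      refine Finset.sum_eq_zero fun x _ => ?_
      by_cases h : x i = 0 <;> simp [h]
    rw [if_neg hij, sub_zero]
    -- The indicators are absorbed as factors at `l = i` and `l = j`, so that the sum over words
    -- factors over places.
    have h1 : ∀ x : Fin n → Fin 2,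
        (∏ l, w (x l)) * ((if x i = 0 then (1 : ℝ) else 0) * if x j = 1 then (1 : ℝ) else 0)
        = ∏ l, (w (x l) * ((if l = i then (if x l = 0 then (1 : ℝ) else 0) else 1)
          * (if l = j then (if x l = 1 then (1 : ℝ) else 0) else 1))) := fun x => by
      rw [Finset.prod_mul_distrib, Finset.prod_mul_distrib]
      simp only [Finset.prod_ite_eq', Finset.mem_univ, if_true]
    have h2 := Finset.prod_univ_sum (fun _ : Fin n => (Finset.univ : Finset (Fin 2)))
      fun l a => w a * ((if l = i then (if a = 0 then (1 : ℝ) else 0) else 1)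
          * (if l = j then (if a = 1 then (1 : ℝ) else 0) else 1))
    rw [Fintype.piFinset_univ] at h2
    rw [Finset.sum_congr rfl fun x _ => h1 x, ← h2]
    have h3 : ∀ l, ∑ a, w a * ((if l = i then (if a = 0 then (1 : ℝ) else 0) else 1)
          * (if l = j then (if a = 1 then (1 : ℝ) else 0) else 1))
        = (if l = i then w 0 else 1) * (if l = j then w 1 else 1) := by
      intro l
      rw [Fin.sum_univ_two]
      by_cases hi : l = i
      · have hj : l ≠ j := fun h => hij (hi.symm.trans h)
        simp [hi, hij]
      · by_cases hj : l = j
        · simp [hj, Ne.symm hij]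
        · simp [hi, hj, hw]
    simp only [h3, Finset.prod_mul_distrib, Finset.prod_ite_eq', Finset.mem_univ, if_true]
  have hx : ∀ x : Fin n → Fin 2, (∏ i, w (x i)) * ((letterCount 0 x : ℝ) * letterCount 1 x)
      = ∑ i, ∑ j, (∏ l, w (x l)) *
        ((if x i = 0 then (1 : ℝ) else 0) * if x j = 1 then (1 : ℝ) else 0) := fun x => by
    rw [hcount, hcount, Finset.sum_mul_sum, Finset.mul_sum]
    simp only [Finset.mul_sum]
  have hsum : ∑ x : Fin n → Fin 2, (∏ i, w (x i)) * ((letterCount 0 x : ℝ) * letterCount 1 x)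
      = ∑ i : Fin n, ∑ j : Fin n, (w 0 * w 1 - if i = j then w 0 * w 1 else 0) := by
    rw [Finset.sum_congr rfl fun x _ => hx x, Finset.sum_comm]
    refine Finset.sum_congr rfl fun i _ => ?_
    rw [Finset.sum_comm]
    exact Finset.sum_congr rfl fun j _ => hpair i j
  rw [hsum]
  simp
  ring

section Source

variable {e : OrthonormalBasis (Fin 2) ℂ (Sys 2)} {p : PMF (DensityOperator (Sys 2))}

theorem sum_toReal_basisState (hp : p.support = {basisState e 0, basisState e 1}) :
    (p (basisState e 0)).toReal + (p (basisState e 1)).toReal = 1 := by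
  have h : ∑' a, p (basisState e a) = ∑' ρ, p ρ :=
    (basisState_injective e).tsum_eq (f := fun ρ => p ρ) fun ρ hρ => by
      have : ρ ∈ p.support := hρ
      rw [hp] at this
      rcases this with h | h
      · exact ⟨0, h.symm⟩
      · exact ⟨1, h.symm⟩
  rw [p.tsum_coe, tsum_fintype, Fin.sum_univ_two] at h
  rw [← ENNReal.toReal_add (p.apply_ne_top _) (p.apply_ne_top _), h, ENNReal.toReal_one]

/-- A tuple with an entry outside the support has weight zero; the remaining tuples are indexed
injectively by words. -/
theorem avgError_eq_sum (hp : p.support = {basisState e 0, basisState e 1}) (n : ℕ)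
    (C : VarLengthCode (Tens 2 n)) :
    avgError p n C = ∑ x : Fin n → Fin 2, (∏ i, (p (basisState e (x i))).toReal) *
      C.error (tensorOp fun i => (basisState e (x i)).1) := by
  refine Eq.trans ?_ (tsum_fintype (L := .unconditional _) (fun x : Fin n → Fin 2 =>
    (∏ i, (p (basisState e (x i))).toReal) *
      C.error (tensorOp fun i => (basisState e (x i)).1)))
  have hinj : Function.Injective
      fun (x : Fin n → Fin 2) (i : Fin n) => basisState e (x i) :=
    fun x y h => funext fun i => basisState_injective e (congrFun h i)
  refine (hinj.tsum_eq (f := fun ρ : Fin n → DensityOperator (Sys 2) =>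
    (∏ i, (p (ρ i)).toReal) * C.error (tensorOp fun i => (ρ i).1)) fun ρ hρ => ?_).symm
  have hρ' : ∀ i, ∃ a, basisState e a = ρ i := fun i => by
    have h1 : (p (ρ i)).toReal ≠ 0 := fun h => hρ <| by
      change (∏ i, (p (ρ i)).toReal) * _ = 0
      rw [Finset.prod_eq_zero (f := fun i => (p (ρ i)).toReal) (Finset.mem_univ i) h, zero_mul]
    have h2 : ρ i ∈ p.support := fun h => h1 (by rw [h, ENNReal.toReal_zero])
    rw [hp] at h2
    rcases h2 with h | h
    · exact ⟨0, h.symm⟩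
    · exact ⟨1, h.symm⟩
  choose x hx using hρ'
  exact ⟨x, funext hx⟩

theorem le_avgError (hp : p.support = {basisState e 0, basisState e 1}) {n : ℕ} (hn : 2 ≤ n) :
    (p (basisState e 0)).toReal * (p (basisState e 1)).toReal / 2304
      ≤ avgError p n (youngCode 2 0 n) := by
  set w : Fin 2 → ℝ := fun a => (p (basisState e a)).toReal with hw
  have hw0 : ∀ a, 0 ≤ w a := fun a => ENNReal.toReal_nonneg
  have hn2 : (2 : ℝ) ≤ n := by exact_mod_cast hn
  have h1 : ∑ x : Fin n → Fin 2, (∏ i, w (x i)) *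
      ((letterCount 0 x : ℝ) * letterCount 1 x / (1152 * (n : ℝ) ^ 2))
      ≤ avgError p n (youngCode 2 0 n) := by
    rw [avgError_eq_sum hp]
    exact Finset.sum_le_sum fun x _ => mul_le_mul_of_nonneg_left
      (letterCount_mul_le_error (by omega) e x) (Finset.prod_nonneg fun i _ => hw0 _)
  refine le_trans ?_ h1
  simp only [← mul_div_assoc, ← Finset.sum_div]
  rw [sum_prod_mul_letterCount w (sum_toReal_basisState hp), le_div_iff₀ (by positivity)]
  have h2 : 0 ≤ w 0 * w 1 := mul_nonneg (hw0 0) (hw0 1)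
  -- For `n ≥ 2` one has `n² - n ≥ n² / 2`, whence `2304 = 2 · 1152`.
  change w 0 * w 1 / 2304 * (1152 * (n : ℝ) ^ 2) ≤ _
  nlinarith [mul_nonneg h2 (by nlinarith : (0 : ℝ) ≤ n * (n - 2))]

theorem not_tendsto_avgError (hp : p.support = {basisState e 0, basisState e 1}) :
    ¬ Tendsto (fun n : ℕ => avgError p n (youngCode 2 0 n)) atTop (𝓝 0) := by
  intro h
  have hpos : ∀ a, 0 < (p (basisState e a)).toReal := fun a => by
    refine ENNReal.toReal_pos ?_ (p.apply_ne_top _)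
    have : basisState e a ∈ p.support := by
      rw [hp]
      fin_cases a <;> simp
    exact this
  have hle := ge_of_tendsto h (eventually_atTop.mpr ⟨2, fun n hn => le_avgError hp hn⟩)
  have := mul_pos (hpos 0) (hpos 1)
  linarith

end Source

end QuantumSource

end

theorem mainTheorem4
    (e : OrthonormalBasis (Fin 2) ℂ (QuantumSource.Sys 2))
    (p : PMF (QuantumSource.DensityOperator (QuantumSource.Sys 2)))
    (hp : p.support = {QuantumSource.pureState (e 0) (e.orthonormal.norm_eq_one 0),
      QuantumSource.pureState (e 1) (e.orthonormal.norm_eq_one 1)}) :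
    (∀ n : ℕ, (QuantumSource.youngCode 2 0 n).IsNormalized) ∧
    ¬ Filter.Tendsto
        (fun n : ℕ => QuantumSource.avgError p n (QuantumSource.youngCode 2 0 n))
        Filter.atTop (nhds 0) ∧
    ∀ P : Set (PMF (QuantumSource.DensityOperator (QuantumSource.Sys 2))), p ∈ P →
      ¬ QuantumSource.IsUniversal P (fun n => QuantumSource.youngCode 2 0 n) :=
  ⟨QuantumSource.youngCode_isNormalized, QuantumSource.not_tendsto_avgError hp,
    fun _ hP h => QuantumSource.not_tendsto_avgError hp (h p hP)⟩
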